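/- Let $N\ge 1$, let $\Omega\subset\mathbb R^N$ be a bounded open set of class $C^{0,1}$, and let $0<s'<s<1$. Here $\Omega$ is of class $C^{0,1}$ if there is $M>0$ such that every $x\in\partial\Omega$ has an open neighbourhood $U$ and a bijection $T$ of the cylinder $Q=\{(x',x_N)\in\mathbb R^{N-1}\times\mathbb R: |x'|<1,\ |x_N|<1\}$ onto $U$ such that $T$ and $T^{-1}$ are Lipschitz with constant $M$, $T(\{x\in Q: x_N>0\})=U\cap\Omega$ and $T(\{x\in Q: x_N=0\})=U\cap\partial\Omega$. Let $a:\overline\Omega\times\overline\Omega\times\mathbb R\to\mathbb R$ be such that for all $(x,y)\in\overline\Omega\times\overline\Omega$ the function $\varphi_{x,y}(t)=a(x,y,|t|)\,t$ for $t\ne0$, $\varphi_{x,y}(0)=0$, is an increasing homeomorphism of $\mathbb R$ onto itself; put $$\Phi_{x,y}(t)=\int_0^t\varphi_{x,y}(\tau)\,d\tau ,\qquad \widehat\Phi_x=\Phi_{x,x},$$ and assume that $(x,y)\mapsto\Phi_{x,y}(t)$ and $x\mapsto\widehat\Phi_x(t)$ are Lebesgue measurable for every $t\ge0$. Assume $$(\Phi_1)\qquad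 1<\varphi^-:=\inf_{x,y\in\overline\Omega,\ t>0}\frac{t\varphi_{x,y}(t)}{\Phi_{x,y}(t)}\ \le\ \varphi^+:=\sup_{x,y\in\overline\Omega,\ t>0}\frac{t\varphi_{x,y}(t)}{\Phi_{x,y}(t)}<\infty ,$$ and $\inf_{x,y\in\Omega}\Phi_{x,y}(1)>0$. Let $W^sL_{\Phi_{x,y}}(\Omega)$ be the space of all measurable $u:\Omega\to\mathbb R$ (modulo equality almost everywhere) such that $\int_\Omega\widehat\Phi_x(\lambda|u(x)|)\,dx<\infty$ for some $\lambda>0$ and $\int_\Omega\int_\Omega\Phi_{x,y}\big(\tfrac{\lambda|u(x)-u(y)|}{|x-y|^s}\big)\tfrac{dx\,dy}{|x-y|^N}<\infty$ for some $\lambda>0$, with the norm $$\|u\|_{s,\Phi_{x,y}}=\inf\Big\{\lambda>0:\int_\Omega\widehat\Phi_x\big(\tfrac{|u(x)|}{\lambda}\big)dx\le1\Big\}+\inf\Big\{\lambda>0:\int_\Omega\int_\Omega\Phi_{x,y}\big(\tfrac{|u(x)-u(y)|}{\lambda|x-y|^s}\big)\tfrac{dx\,dy}{|x-y|^N}\le1\Big\}.$$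 Set $\varphi^*_{s'}=\frac{N\varphi^-}{N-s'\varphi^-}$ if $s'\varphi^-<N$ and $\varphi^*_{s'}=\infty$ otherwise. Then: - if $s'\varphi^-<N$, then $W^sL_{\Phi_{x,y}}(\Omega)$ embeds continuously into $L^q(\Omega)$ for all $q\in[1,\varphi^*_{s'}]$, and compactly for all $q\in[1,\varphi^*_{s'})$; - if $s'\varphi^-=N$, then $W^sL_{\Phi_{x,y}}(\Omega)$ embeds continuously into $L^q(\Omega)$ for all $q\in[1,\infty]$, and compactly for all $q\in[1,\infty)$; - if $s'\varphi^->N$, then $W^sL_{\Phi_{x,y}}(\Omega)$ embeds compactly into $L^\infty(\Omega)$. -/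

import Mathlib

open MeasureTheory Set Filter Topology
open scoped ENNReal NNReal

noncomputable section

namespace FracMusielak

/-- Euclidean space `ℝ^N`. -/
abbrev E (N : ℕ) : Type := EuclideanSpace ℝ (Fin N)

/-! ### Domains with Lipschitz boundary -/

/-- The open cylinder `{(x', x_N) : |x'| < 1, |x_N| < 1}` in `ℝ^(N-1) × ℝ`. -/
def cyl (N : ℕ) : Set (E (N - 1) × ℝ) := {z | ‖z.1‖ < 1 ∧ |z.2| < 1}

/-- The upper half `{0 < x_N}` of the cylinder. -/
def cylPos (N : ℕ) : Set (E (N - 1) × ℝ) := {z | z ∈ cyl N ∧ 0 < z.2}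

/-- The middle section `{x_N = 0}` of the cylinder. -/
def cylZero (N : ℕ) : Set (E (N - 1) × ℝ) := {z | z ∈ cyl N ∧ z.2 = 0}

/-- `Ω` is of class `C^{0,1}` (for `N ≥ 1`): there is a constant `M` such that every boundary
point has an open neighbourhood `U` which is the image of the cylinder under a bijection `T` that
is Lipschitz with Lipschitz inverse `T'`, both with constant `M`, and that carries the upper half
of the cylinder onto `U ∩ Ω` and its middle section onto `U ∩ ∂Ω`. -/
def IsLipschitzDomain {N : ℕ} (Ω : Set (E N)) : Prop :=
  ∃ M : ℝ≥0, ∀ x ∈ frontier Ω, ∃ U : Set (E N), IsOpen U ∧ x ∈ U ∧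
    ∃ (T : E (N - 1) × ℝ → E N) (T' : E N → E (N - 1) × ℝ),
      InvOn T' T (cyl N) U ∧ T '' cyl N = U ∧
      LipschitzOnWith M T (cyl N) ∧ LipschitzOnWith M T' U ∧
      T '' cylPos N = U ∩ Ω ∧ T '' cylZero N = U ∩ frontier Ω

/-! ### Musielak functions -/

/-- `φ_{x,y}(t) = a(x,y,|t|) t` for `t ≠ 0`, and `φ_{x,y}(0) = 0`. -/
def phi {N : ℕ} (a : E N → E N → ℝ → ℝ) (x y : E N) (t : ℝ) : ℝ :=
  if t = 0 then 0 else a x y |t| * t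

/-- `Φ_{x,y}(t) = ∫_0^t φ_{x,y}(τ) dτ`. -/
def Phi {N : ℕ} (a : E N → E N → ℝ → ℝ) (x y : E N) (t : ℝ) : ℝ :=
  ∫ τ in (0 : ℝ)..t, phi a x y τ

/-- The standing assumptions: for all `x, y` in the closure of `Ω` the function `φ_{x,y}` is an
increasing homeomorphism of `ℝ` onto itself, and for every `t ≥ 0` the functions
`(x, y) ↦ Φ_{x,y}(t)` and `x ↦ Φ_{x,x}(t)` are Lebesgue measurable, so that `Φ_{x,y}` and
`Φ_{x,x}` are Musielak functions. -/
structure IsMusielak {N : ℕ} (Ω : Set (E N)) (a : E N → E N → ℝ → ℝ) : Prop where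
  strictMono : ∀ x ∈ closure Ω, ∀ y ∈ closure Ω, StrictMono (phi a x y)
  isHomeomorph : ∀ x ∈ closure Ω, ∀ y ∈ closure Ω, IsHomeomorph (phi a x y)
  measurable : ∀ t : ℝ, 0 ≤ t → AEMeasurable (fun z : E N × E N => Phi a z.1 z.2 t)
    ((volume : Measure (E N × E N)).restrict (closure Ω ×ˢ closure Ω))
  measurable_diag : ∀ t : ℝ, 0 ≤ t → AEMeasurable (fun x : E N => Phi a x x t)
    ((volume : Measure (E N)).restrict (closure Ω))

/-- All values `t φ_{x,y}(t) / Φ_{x,y}(t)` with `x, y` in the closure of `Ω` and `t > 0`. -/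
def growthSet {N : ℕ} (Ω : Set (E N)) (a : E N → E N → ℝ → ℝ) : Set ℝ :=
  {r | ∃ x ∈ closure Ω, ∃ y ∈ closure Ω, ∃ t : ℝ, 0 < t ∧ r = t * phi a x y t / Phi a x y t}

/-- The lower growth exponent `φ⁻`. -/
def phiMinus {N : ℕ} (Ω : Set (E N)) (a : E N → E N → ℝ → ℝ) : ℝ := sInf (growthSet Ω a)

/-- The condition `1 < φ⁻ ≤ φ⁺ < ∞`, where `φ⁺` is the supremum of `growthSet Ω a`. -/
def GrowthCondition {N : ℕ} (Ω : Set (E N)) (a : E N → E N → ℝ → ℝ) : Prop :=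
  1 < phiMinus Ω a ∧ BddAbove (growthSet Ω a)

/-! ### The fractional Musielak-Sobolev space -/

/-- The modular `∫_Ω Φ_{x,x}(|u(x)|) dx`. -/
def modular {N : ℕ} (Ω : Set (E N)) (a : E N → E N → ℝ → ℝ) (u : E N → ℝ) : ℝ≥0∞ :=
  ∫⁻ x in Ω, ENNReal.ofReal (Phi a x x |u x|)

/-- The modular `∫_Ω ∫_Ω Φ_{x,y}(|u(x) - u(y)| / |x - y|^s) |x - y|^{-N} dx dy`. -/
def gagliardoModular {N : ℕ} (Ω : Set (E N)) (a : E N → E N → ℝ → ℝ) (s : ℝ) (u : E N → ℝ) :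
    ℝ≥0∞ :=
  ∫⁻ x in Ω, ∫⁻ y in Ω,
    ENNReal.ofReal (Phi a x y (|u x - u y| / ‖x - y‖ ^ s) / ‖x - y‖ ^ N)

/-- `u` (a function whose values outside `Ω` are irrelevant) belongs to the fractional
Musielak-Sobolev space `W^s L_{Φ_{x,y}}(Ω)`. -/
def MemW {N : ℕ} (Ω : Set (E N)) (a : E N → E N → ℝ → ℝ) (s : ℝ) (u : E N → ℝ) : Prop :=
  AEStronglyMeasurable u (volume.restrict Ω) ∧
  (∃ l : ℝ, 0 < l ∧ modular Ω a (fun x => l * u x) < ∞) ∧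
  (∃ l : ℝ, 0 < l ∧ gagliardoModular Ω a s (fun x => l * u x) < ∞)

/-- The Luxemburg norm of the Musielak space with Musielak function `Φ_{x,x}`. -/
def luxNorm {N : ℕ} (Ω : Set (E N)) (a : E N → E N → ℝ → ℝ) (u : E N → ℝ) : ℝ :=
  sInf {l : ℝ | 0 < l ∧ modular Ω a (fun x => u x / l) ≤ 1}

/-- The Gagliardo seminorm `[u]_{s,Φ_{x,y}}`. -/
def gagliardoSeminorm {N : ℕ} (Ω : Set (E N)) (a : E N → E N → ℝ → ℝ) (s : ℝ) (u : E N → ℝ) : ℝ :=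
  sInf {l : ℝ | 0 < l ∧ gagliardoModular Ω a s (fun x => u x / l) ≤ 1}

/-- The norm of `W^s L_{Φ_{x,y}}(Ω)`. -/
def normW {N : ℕ} (Ω : Set (E N)) (a : E N → E N → ℝ → ℝ) (s : ℝ) (u : E N → ℝ) : ℝ :=
  luxNorm Ω a u + gagliardoSeminorm Ω a s u

/-! ### Embeddings into Lebesgue spaces -/

/-- `W^s L_{Φ_{x,y}}(Ω)` is continuously embedded in `L^q(Ω)`. -/
def ContinuouslyEmbedded {N : ℕ} (Ω : Set (E N)) (a : E N → E N → ℝ → ℝ) (s : ℝ) (q : ℝ≥0∞) :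
    Prop :=
  ∃ C : ℝ, 0 ≤ C ∧ ∀ u : E N → ℝ, MemW Ω a s u →
    MemLp u q (volume.restrict Ω) ∧
    eLpNorm u q (volume.restrict Ω) ≤ ENNReal.ofReal (C * normW Ω a s u)

/-- `W^s L_{Φ_{x,y}}(Ω)` is compactly embedded in `L^q(Ω)`: the embedding is continuous, and every
bounded sequence has a subsequence that converges in `L^q(Ω)`. -/
def CompactlyEmbedded {N : ℕ} (Ω : Set (E N)) (a : E N → E N → ℝ → ℝ) (s : ℝ) (q : ℝ≥0∞) :
    Prop :=
  ContinuouslyEmbedded Ω a s q ∧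
  ∀ u : ℕ → E N → ℝ, (∀ n, MemW Ω a s (u n)) → (∃ R : ℝ, ∀ n, normW Ω a s (u n) ≤ R) →
    ∃ (v : E N → ℝ) (k : ℕ → ℕ), MemLp v q (volume.restrict Ω) ∧ StrictMono k ∧
      Tendsto (fun n => eLpNorm (fun x => u (k n) x - v x) q (volume.restrict Ω)) atTop (𝓝 0)

/-- The critical exponent `φ*_{s'}`, equal to `N φ⁻ / (N - s' φ⁻)` if `s' φ⁻ < N` and to `∞`
otherwise. -/
def critExp {N : ℕ} (Ω : Set (E N)) (a : E N → E N → ℝ → ℝ) (s' : ℝ) : ℝ≥0∞ :=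
  if s' * phiMinus Ω a < N then
    ENNReal.ofReal (N * phiMinus Ω a / (N - s' * phiMinus Ω a))
  else ∞

end FracMusielak

end

/-!
Put `p = φ⁻`. Integrating `p Φ ≤ t φ` gives `t ^ p ≤ 1 + Φ t / c` for the lower bound `c` of
`Φ · · 1`, and `|x - y| ^ ((s - σ) p - N)` is integrable on a bounded set for `σ < s`; so the space
`W^s L_Φ` embeds into the fractional Sobolev space `W^{σ, p}` for every `σ < s`. The loss from `s`
to `σ` is harmless because `s' < s`, and `σ > s'` even gives compactness at the exponent `φ*_{s'}`.

On `W^{σ, p}` the geometry of `Ω` enters only through the bound `|B(x, r) ∩ Ω| ≥ c r ^ N`, which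
a Lipschitz boundary provides because the charts carry interior balls of the half cylinder to
sets that contain balls of comparable radius. With `g x` the `p`-th root of
`∫ |u x - u y| ^ p / |x - y| ^ (N + σ p) dy`, whose `L ^ p` norm is the seminorm, this bound gives
the Poincaré inequality: `u x` differs from `u` on `B(x, r) ∩ Ω` by at most `C r ^ σ g x` in mean.

If `σ p < N`, balancing the radius between this error and the bound `C r ^ (-N / q) ‖u‖_q` for the
average raises integrability from `q` to `p + (σ p / N) q`, and iteration reaches every exponent
below `N p / (N - σ p)`. If `σ p > N`, telescoping over the radii `r 2 ^ (-k)` bounds `u`. In both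
cases the seminorm enters with an arbitrarily small constant, so compactness only has to be shown in
`L ^ 1`, where up to a small error `u` is determined by its averages over finitely many balls.
-/

noncomputable section

namespace FractionalSobolev

open Metric

section Averages

variable {X : Type*} [PseudoMetricSpace X] [MeasurableSpace X]

/-- Lower Ahlfors regularity of dimension `d` at the points of `S`, at scales up to `1`. For
`μ = volume.restrict Ω` and `S = Ω ⊆ ℝ^d` it is the measure density condition on `Ω`. -/
def IsLowerRegularOn (μ : Measure X) (S : Set X) (d : ℝ) (c : ℝ≥0) : Prop :=
  ∀ x ∈ S, ∀ r : ℝ≥0, 0 < r → r ≤ 1 → ((c * r ^ d : ℝ≥0) : ℝ≥0∞) ≤ μ (ball x r)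

theorem setLAverage_le_eLpNorm' {α : Type*} [MeasurableSpace α] {μ : Measure α} {f : α → ℝ≥0∞}
    (hf : AEMeasurable f μ) {q : ℝ} (hq : 1 ≤ q) (s : Set α) :
    ⨍⁻ x in s, f x ∂μ ≤ μ s ^ (-(1 / q)) * eLpNorm' f q μ := by
  set ν := (μ s)⁻¹ • μ.restrict s with hν
  have hq0 : 0 < q := one_pos.trans_le hq
  have hmass : ν univ ≤ 1 := by simp [hν, ENNReal.inv_mul_le_one]
  have hexp : 0 ≤ 1 / (1 : ℝ) - 1 / q := by
    rw [one_div_one, sub_nonneg]; exact (div_le_one hq0).2 hq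
  calc ⨍⁻ x in s, f x ∂μ = eLpNorm' f 1 ν := by simp [laverage, eLpNorm', hν]
    _ ≤ eLpNorm' f q ν * ν univ ^ (1 / (1 : ℝ) - 1 / q) :=
      eLpNorm'_le_eLpNorm'_mul_rpow_measure_univ one_pos hq
        (hf.restrict.smul_measure _).aestronglyMeasurable
    _ ≤ eLpNorm' f q ν := mul_le_of_le_one_right' (ENNReal.rpow_le_one hmass hexp)
    _ = μ s ^ (-(1 / q)) * eLpNorm' f q (μ.restrict s) := by
      rw [hν, eLpNorm'_smul_measure hq0.le, ENNReal.inv_rpow, ENNReal.rpow_neg]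
    _ ≤ μ s ^ (-(1 / q)) * eLpNorm' f q μ := by
      gcongr
      exact Measure.restrict_le_self

namespace IsLowerRegularOn

variable {μ : Measure X} {S : Set X} {d : ℝ} {c : ℝ≥0}

theorem measure_ball_pos (h : IsLowerRegularOn μ S d c) (hc : 0 < c) {x : X} (hx : x ∈ S)
    {r : ℝ≥0} (hr : 0 < r) (hr1 : r ≤ 1) : 0 < μ (ball x r) :=
  (ENNReal.coe_pos.2 (mul_pos hc (NNReal.rpow_pos hr))).trans_le (h x hx r hr hr1)

theorem setLAverage_ball_le (h : IsLowerRegularOn μ S d c) (hc : 0 < c) {x : X} (hx : x ∈ S)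
    {r : ℝ≥0} (hr : 0 < r) (hr1 : r ≤ 1) {f : X → ℝ≥0∞} (hf : AEMeasurable f μ) {q : ℝ}
    (hq : 1 ≤ q) :
    ⨍⁻ z in ball x r, f z ∂μ ≤
      ((c ^ (-(1 / q)) * r ^ (-(d / q)) : ℝ≥0) : ℝ≥0∞) * eLpNorm' f q μ := by
  refine (setLAverage_le_eLpNorm' hf hq _).trans (mul_le_mul_left ?_ _)
  have hrd : c * r ^ d ≠ 0 := (mul_pos hc (NNReal.rpow_pos hr)).ne'
  calc μ (ball x r) ^ (-(1 / q)) ≤ ((c * r ^ d : ℝ≥0) : ℝ≥0∞) ^ (-(1 / q)) := by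
          simp only [ENNReal.rpow_neg]
          gcongr
          exact h x hx r hr hr1
    _ = ((c ^ (-(1 / q)) * r ^ (-(d / q)) : ℝ≥0) : ℝ≥0∞) := by
        rw [← ENNReal.coe_rpow_of_ne_zero hrd, NNReal.mul_rpow, ← NNReal.rpow_mul]
        congr 4
        ring

end IsLowerRegularOn

end Averages

section HolderQuotient

variable {X F : Type*} [MetricSpace X] [NormedAddCommGroup F] [NormedSpace ℝ F]

/-- The difference quotient `(u x - u y) / |x - y|^β` on pairs of points. Its `L^p` norm for
`μ ⊗ μ` and `β = d / p + σ` is the Gagliardo seminorm, its supremum the Hölder seminorm. The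
diagonal contributes `0`. -/
def holderQuotient (β : ℝ) (u : X → F) (z : X × X) : F :=
  dist z.1 z.2 ^ (-β) • (u z.1 - u z.2)

theorem holderQuotient_sub (β : ℝ) (u v : X → F) :
    holderQuotient β (u - v) = holderQuotient β u + -holderQuotient β v := by
  funext z
  simp only [holderQuotient, Pi.sub_apply, Pi.add_apply, Pi.neg_apply, ← smul_neg, ← smul_add]
  congr 1
  abel

theorem holderQuotient_const_smul (β k : ℝ) (u : X → F) :
    holderQuotient β (k • u) = k • holderQuotient β u := by
  funext z
  simp only [holderQuotient, Pi.smul_apply, ← smul_sub]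
  exact smul_comm _ _ _

theorem enorm_sub_le_rpow_mul_holderQuotient {β : ℝ} (hβ : 0 ≤ β) (u : X → F) {x z : X} {R : ℝ≥0}
    (hR : dist x z ≤ R) : ‖u x - u z‖ₑ ≤ ((R ^ β : ℝ≥0) : ℝ≥0∞) * ‖holderQuotient β u (x, z)‖ₑ := by
  rcases eq_or_ne x z with rfl | hxz
  · simp
  have hdist : 0 < dist x z := dist_pos.2 hxz
  have hcancel : u x - u z = dist x z ^ β • holderQuotient β u (x, z) := by
    rw [holderQuotient, smul_smul, ← Real.rpow_add hdist, add_neg_cancel, Real.rpow_zero, one_smul]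
  calc ‖u x - u z‖ₑ = ‖dist x z ^ β‖ₑ * ‖holderQuotient β u (x, z)‖ₑ := by rw [hcancel, enorm_smul]
    _ ≤ _ := by
      gcongr
      rw [Real.enorm_of_nonneg (by positivity), ← ENNReal.ofReal_coe_nnreal, NNReal.coe_rpow]
      gcongr

variable [MeasurableSpace X] {μ : Measure X} {d p σ : ℝ} {u v : X → F}

/-- The Gagliardo seminorm `(∫∫ |u x - u y|^p / |x - y|^(d + σ p))^(1 / p)` of order `σ` and
exponent `p` on a space of dimension `d`. -/
def gagliardoNorm (μ : Measure X) (d p σ : ℝ) (u : X → F) : ℝ≥0∞ :=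
  eLpNorm' (holderQuotient (d / p + σ) u) p (μ.prod μ)

/-- The pointwise quantity `(∫ |u x - u y|^p / |x - y|^(d + σ p) dy)^(1 / p)`, which plays the part
of a gradient of order `σ`: its `L^p` norm is the Gagliardo seminorm. -/
def gagliardoGradient (μ : Measure X) (d p σ : ℝ) (u : X → F) (x : X) : ℝ≥0∞ :=
  eLpNorm' (fun y => holderQuotient (d / p + σ) u (x, y)) p μ

theorem gagliardoNorm_const_smul (hp : 0 < p) (k : ℝ) (u : X → F) :
    gagliardoNorm μ d p σ (k • u) = ‖k‖ₑ * gagliardoNorm μ d p σ u := by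
  rw [gagliardoNorm, gagliardoNorm, holderQuotient_const_smul, eLpNorm'_const_smul k hp]

variable [OpensMeasurableSpace X]

theorem aestronglyMeasurable_holderQuotient_left (hu : AEStronglyMeasurable u μ) (β : ℝ) (x : X) :
    AEStronglyMeasurable (fun y => holderQuotient β u (x, y)) μ :=
  ((continuous_const.dist continuous_id).measurable.pow_const (-β)).aestronglyMeasurable.smul
    ((aestronglyMeasurable_const (b := u x)).sub hu)

variable [SecondCountableTopology X]

theorem aestronglyMeasurable_holderQuotient (hu : AEStronglyMeasurable u μ) (β : ℝ) :
    AEStronglyMeasurable (holderQuotient β u) (μ.prod μ) :=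
  (measurable_dist.pow_const (-β)).aestronglyMeasurable.smul (hu.comp_fst.sub hu.comp_snd)

theorem gagliardoNorm_sub_le (hu : AEStronglyMeasurable u μ) (hv : AEStronglyMeasurable v μ)
    (hp : 1 ≤ p) :
    gagliardoNorm μ d p σ (u - v) ≤ gagliardoNorm μ d p σ u + gagliardoNorm μ d p σ v := by
  simp only [gagliardoNorm]
  rw [holderQuotient_sub, ← eLpNorm'_neg (holderQuotient _ v)]
  exact eLpNorm'_add_le (aestronglyMeasurable_holderQuotient hu _)
    (aestronglyMeasurable_holderQuotient hv _).neg hp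

variable [SFinite μ]

theorem aemeasurable_gagliardoGradient (hu : AEStronglyMeasurable u μ) :
    AEMeasurable (gagliardoGradient μ d p σ u) μ :=
  (((aestronglyMeasurable_holderQuotient hu _).enorm.pow_const p).lintegral_prod_right').pow_const _

theorem eLpNorm'_gagliardoGradient (hu : AEStronglyMeasurable u μ) (hp : 0 < p) :
    eLpNorm' (gagliardoGradient μ d p σ u) p μ = gagliardoNorm μ d p σ u := by
  simp only [gagliardoNorm, gagliardoGradient, eLpNorm', enorm_eq_self, one_div,
    ENNReal.rpow_inv_rpow hp.ne']
  rw [lintegral_prod _ ((aestronglyMeasurable_holderQuotient hu _).enorm.pow_const p)]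

end HolderQuotient

section Poincare

variable {X F : Type*} [MetricSpace X] [MeasurableSpace X] [OpensMeasurableSpace X]
  [NormedAddCommGroup F] [NormedSpace ℝ F] {μ : Measure X} {S : Set X} {d p σ : ℝ} {c : ℝ≥0}
  {u : X → F}

/-- The constant in the fractional Poincaré inequality on balls. -/
def poincareConst (d p σ : ℝ) (c : ℝ≥0) : ℝ≥0 := 2 ^ (d / p + σ) * c ^ (-(1 / p))

theorem IsLowerRegularOn.setLAverage_enorm_sub_le (h : IsLowerRegularOn μ S d c) (hc : 0 < c)
    (hd : 0 ≤ d) (hp : 1 ≤ p) (hσ : 0 ≤ σ) (hu : AEStronglyMeasurable u μ) {y : X} (hy : y ∈ S)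
    {r : ℝ≥0} (hr : 0 < r) (hr1 : r ≤ 1) {x : X} (hx : dist x y ≤ r) :
    ⨍⁻ z in ball y r, ‖u x - u z‖ₑ ∂μ ≤
      ((poincareConst d p σ c * r ^ σ : ℝ≥0) : ℝ≥0∞) * gagliardoGradient μ d p σ u x := by
  have hβ : 0 ≤ d / p + σ := add_nonneg (div_nonneg hd (zero_le_one.trans hp)) hσ
  have hquot := aestronglyMeasurable_holderQuotient_left hu (d / p + σ) x
  have hpt : ∀ z ∈ ball y r, ‖u x - u z‖ₑ ≤
      (((2 * r) ^ (d / p + σ) : ℝ≥0) : ℝ≥0∞) * ‖holderQuotient (d / p + σ) u (x, z)‖ₑ := by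
    refine fun z hz => enorm_sub_le_rpow_mul_holderQuotient hβ u ?_
    push_cast
    linarith [dist_triangle_right x z y, (mem_ball.1 hz).le]
  calc ⨍⁻ z in ball y r, ‖u x - u z‖ₑ ∂μ
      ≤ ⨍⁻ z in ball y r, (((2 * r) ^ (d / p + σ) : ℝ≥0) : ℝ≥0∞) *
          ‖holderQuotient (d / p + σ) u (x, z)‖ₑ ∂μ :=
        laverage_mono_ae (ae_restrict_of_forall_mem measurableSet_ball hpt)
    _ = (((2 * r) ^ (d / p + σ) : ℝ≥0) : ℝ≥0∞) *
          ⨍⁻ z in ball y r, ‖holderQuotient (d / p + σ) u (x, z)‖ₑ ∂μ := by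
        rw [setLAverage_eq, setLAverage_eq, lintegral_const_mul' _ _ ENNReal.coe_ne_top,
          mul_div_assoc]
    _ ≤ (((2 * r) ^ (d / p + σ) : ℝ≥0) : ℝ≥0∞) *
          (((c ^ (-(1 / p)) * r ^ (-(d / p)) : ℝ≥0) : ℝ≥0∞) * gagliardoGradient μ d p σ u x) := by
        gcongr
        refine (h.setLAverage_ball_le hc hy hr hr1 hquot.enorm hp).trans_eq ?_
        rw [eLpNorm'_enorm, gagliardoGradient]
    _ = _ := by
        rw [← mul_assoc, ← ENNReal.coe_mul, poincareConst, NNReal.mul_rpow,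
          NNReal.rpow_add hr.ne', NNReal.rpow_neg r]
        have : r ^ (d / p) ≠ 0 := (NNReal.rpow_pos hr).ne'
        congr 2
        field_simp

theorem IsLowerRegularOn.enorm_le_gradient_add_setLAverage [IsFiniteMeasure μ]
    (h : IsLowerRegularOn μ S d c) (hc : 0 < c)
    (hd : 0 ≤ d) (hp : 1 ≤ p) (hσ : 0 ≤ σ) (hu : AEStronglyMeasurable u μ) {y : X} (hy : y ∈ S)
    {r : ℝ≥0} (hr : 0 < r) (hr1 : r ≤ 1) {x : X} (hx : dist x y ≤ r) :
    ‖u x‖ₑ ≤ ((poincareConst d p σ c * r ^ σ : ℝ≥0) : ℝ≥0∞) * gagliardoGradient μ d p σ u x +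
      ⨍⁻ z in ball y r, ‖u z‖ₑ ∂μ := by
  have : NeZero (μ.restrict (ball y r)) :=
    ⟨Measure.restrict_eq_zero.not.2 (h.measure_ball_pos hc hy hr hr1).ne'⟩
  have hmeas : AEMeasurable (fun z => ‖u x - u z‖ₑ) (μ.restrict (ball y r)) :=
    (aestronglyMeasurable_const.sub hu.restrict).enorm
  calc ‖u x‖ₑ = ⨍⁻ _ in ball y r, ‖u x‖ₑ ∂μ := (laverage_const _ _).symm
    _ ≤ ⨍⁻ z in ball y r, (‖u x - u z‖ₑ + ‖u z‖ₑ) ∂μ :=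
      laverage_mono_ae (.of_forall fun z => by simpa using enorm_add_le (u x - u z) (u z))
    _ = ⨍⁻ z in ball y r, ‖u x - u z‖ₑ ∂μ + ⨍⁻ z in ball y r, ‖u z‖ₑ ∂μ :=
      lintegral_add_left' (hmeas.smul_measure _) _
    _ ≤ _ := by
      gcongr
      exact h.setLAverage_enorm_sub_le hc hd hp hσ hu hy hr hr1 hx

end Poincare

section Ehrling

variable {X F : Type*} [MetricSpace X] [MeasurableSpace X] [NormedAddCommGroup F]
  [NormedSpace ℝ F] {μ : Measure X} {d p σ : ℝ} {q₀ q q' : ℝ≥0∞}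

/-- An Ehrling inequality between the Gagliardo seminorm and two Lebesgue norms: the `L^q` norm is
at most an arbitrarily small multiple of the seminorm plus a multiple of the `L^q₀` norm. The small
factor turns compactness in `L^q₀` into compactness in `L^q`. -/
def Ehrling (F : Type*) [NormedAddCommGroup F] [NormedSpace ℝ F] (μ : Measure X) (d p σ : ℝ)
    (q₀ q : ℝ≥0∞) : Prop :=
  ∀ ε : ℝ≥0, 0 < ε → ∃ C : ℝ≥0, ∀ u : X → F, AEStronglyMeasurable u μ →
    eLpNorm u q μ ≤ ε * gagliardoNorm μ d p σ u + C * eLpNorm u q₀ μ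

theorem Ehrling.refl (F : Type*) [NormedAddCommGroup F] [NormedSpace ℝ F] (μ : Measure X)
    (d p σ : ℝ) (q : ℝ≥0∞) : Ehrling F μ d p σ q q :=
  fun _ _ => ⟨1, fun _ _ => by rw [ENNReal.coe_one, one_mul]; exact le_add_self⟩

theorem Ehrling.trans (h : Ehrling F μ d p σ q₀ q) (h' : Ehrling F μ d p σ q q') :
    Ehrling F μ d p σ q₀ q' := by
  intro ε hε
  obtain ⟨C', hC'⟩ := h' (ε / 2) (half_pos hε)
  obtain ⟨C, hC⟩ := h (ε / 2 / (C' + 1)) (by positivity)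
  refine ⟨C' * C, fun u hu => ?_⟩
  have hsmall : ε / 2 + C' * (ε / 2 / (C' + 1)) ≤ ε := by
    calc ε / 2 + C' * (ε / 2 / (C' + 1)) ≤ ε / 2 + (C' + 1) * (ε / 2 / (C' + 1)) := by
          gcongr
          exact le_self_add
      _ = ε := by rw [mul_div_cancel₀ _ (by positivity), add_halves]
  calc eLpNorm u q' μ ≤ (ε / 2 : ℝ≥0) * gagliardoNorm μ d p σ u + C' * eLpNorm u q μ := hC' u hu
    _ ≤ (ε / 2 : ℝ≥0) * gagliardoNorm μ d p σ u + C' *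
        ((ε / 2 / (C' + 1) : ℝ≥0) * gagliardoNorm μ d p σ u + C * eLpNorm u q₀ μ) := by
      gcongr
      exact hC u hu
    _ = (ε / 2 + C' * (ε / 2 / (C' + 1)) : ℝ≥0) * gagliardoNorm μ d p σ u +
        (C' * C : ℝ≥0) * eLpNorm u q₀ μ := by
      simp only [ENNReal.coe_add, ENNReal.coe_mul]
      ring
    _ ≤ _ := by gcongr

theorem Ehrling.of_le [IsFiniteMeasure μ] (hq : q ≠ 0) (hqq : q ≤ q') :
    Ehrling F μ d p σ q' q := by
  intro ε _
  have hexp : 0 ≤ 1 / q.toReal - 1 / q'.toReal := by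
    rcases eq_or_ne q' ∞ with rfl | hq'
    · simp
    · exact sub_nonneg.2 (one_div_le_one_div_of_le
        (ENNReal.toReal_pos hq (ne_top_of_le_ne_top hq' hqq)) (ENNReal.toReal_mono hq' hqq))
  refine ⟨(μ univ ^ (1 / q.toReal - 1 / q'.toReal)).toNNReal, fun u hu => ?_⟩
  rw [ENNReal.coe_toNNReal (ENNReal.rpow_ne_top_of_nonneg hexp (measure_ne_top _ _))]
  refine (eLpNorm_le_eLpNorm_mul_rpow_measure_univ hqq hu).trans ?_
  rw [mul_comm]
  exact le_add_self

theorem Ehrling.of_normalized (hp : 0 < p)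
    (h : ∀ ε : ℝ≥0, 0 < ε → ∃ C : ℝ≥0, ∀ u : X → F, AEStronglyMeasurable u μ →
      gagliardoNorm μ d p σ u ≤ 1 → eLpNorm u q μ ≤ ε + C * eLpNorm u q₀ μ) :
    Ehrling F μ d p σ q₀ q := by
  intro ε hε
  obtain ⟨C, hC⟩ := h ε hε
  refine ⟨C, fun u hu => ?_⟩
  have hscaled : ∀ t : ℝ≥0, 0 < t → gagliardoNorm μ d p σ u ≤ t →
      eLpNorm u q μ ≤ ε * t + C * eLpNorm u q₀ μ := by
    intro t ht hut
    have ht0 : (t : ℝ≥0∞) ≠ 0 := ENNReal.coe_ne_zero.2 ht.ne'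
    have hinv : ‖(t : ℝ)⁻¹‖ₑ = (t : ℝ≥0∞)⁻¹ := by
      rw [enorm_inv (NNReal.coe_ne_zero.2 ht.ne'), NNReal.enorm_eq]
    have hle := hC ((t : ℝ)⁻¹ • u) (hu.const_smul _) (by
      rw [gagliardoNorm_const_smul hp, hinv, mul_comm, ← div_eq_mul_inv]
      exact ENNReal.div_le_of_le_mul (by rwa [one_mul]))
    rw [eLpNorm_const_smul, eLpNorm_const_smul, hinv, mul_comm, ← div_eq_mul_inv,
      ENNReal.div_le_iff ht0 ENNReal.coe_ne_top] at hle
    refine hle.trans_eq ?_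
    rw [add_mul, mul_assoc (C : ℝ≥0∞), mul_right_comm,
      ENNReal.inv_mul_cancel ht0 ENNReal.coe_ne_top, one_mul]
  rcases eq_or_ne (gagliardoNorm μ d p σ u) ∞ with htop | hfin
  · simp [htop, hε.ne']
  refine ENNReal.le_of_forall_pos_le_add fun δ hδ _ => ?_
  lift gagliardoNorm μ d p σ u to ℝ≥0 using hfin with G
  refine (hscaled (G + δ / ε) (by positivity) (by simp)).trans_eq ?_
  rw [← ENNReal.coe_mul, mul_add, mul_div_cancel₀ _ hε.ne']
  push_cast
  ring

theorem Ehrling.tendsto_eLpNorm {ι : Type*} {l : Filter ι} {q₀ q : ℝ≥0∞}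
    (hE : Ehrling F μ d p σ q₀ q) {w : ι → X → F} (hw : ∀ i, AEStronglyMeasurable (w i) μ) {K : ℝ≥0}
    (hK : ∀ i, gagliardoNorm μ d p σ (w i) ≤ K)
    (hlim : Tendsto (fun i => eLpNorm (w i) q₀ μ) l (𝓝 0)) :
    Tendsto (fun i => eLpNorm (w i) q μ) l (𝓝 0) := by
  refine ENNReal.tendsto_nhds_zero.2 fun ε hε => ?_
  obtain ⟨δ, hδ, hδε⟩ := ENNReal.lt_iff_exists_nnreal_btwn.1 hε
  have hδ0 : 0 < δ := ENNReal.coe_pos.1 hδ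
  obtain ⟨C, hC⟩ := hE (δ / 2 / (K + 1)) (by positivity)
  have hsmall : δ / 2 / (K + 1) * K ≤ δ / 2 := by
    rw [div_mul_eq_mul_div]
    exact div_le_of_le_mul₀ (by positivity) (by positivity) (by gcongr; exact le_self_add)
  have hlimC : Tendsto (fun i => C * eLpNorm (w i) q₀ μ) l (𝓝 0) := by
    simpa using ENNReal.Tendsto.const_mul hlim (.inr ENNReal.coe_ne_top)
  have hδ2 : (0 : ℝ≥0∞) < (δ / 2 : ℝ≥0) := ENNReal.coe_pos.2 (half_pos hδ0)
  filter_upwards [hlimC.eventually_le_const hδ2] with i hi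
  calc eLpNorm (w i) q μ ≤ (δ / 2 / (K + 1) : ℝ≥0) * K + (δ / 2 : ℝ≥0) := by
        refine (hC (w i) (hw i)).trans ?_
        gcongr
        exact hK i
    _ ≤ δ := by
        rw [← ENNReal.coe_mul, ← ENNReal.coe_add, ENNReal.coe_le_coe]
        exact (add_le_add_left hsmall _).trans_eq (add_halves δ)
    _ ≤ ε := hδε.le

end Ehrling

section Subcritical

theorem exists_balancing_radius {σ t : ℝ} (hσ : 0 < σ) (ht : 0 < t) {η : ℝ≥0} (hη : 0 < η)
    (hη1 : η ≤ 1) (g : ℝ≥0∞) :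
    ∃ r : ℝ≥0, 0 < r ∧ r ≤ 1 ∧
      ((r ^ σ : ℝ≥0) : ℝ≥0∞) * g ≤ (η ^ σ : ℝ≥0) * (1 + g) ^ (t / (σ + t)) ∧
      ((r ^ (-t) : ℝ≥0) : ℝ≥0∞) ≤ (η ^ (-t) : ℝ≥0) * (1 + g) ^ (t / (σ + t)) := by
  have hσt : 0 < σ + t := add_pos hσ ht
  have hθ : 0 < t / (σ + t) := div_pos ht hσt
  have hησ : ((η ^ σ : ℝ≥0) : ℝ≥0∞) ≠ 0 := ENNReal.coe_ne_zero.2 (NNReal.rpow_pos hη).ne'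
  have hηt : ((η ^ (-t) : ℝ≥0) : ℝ≥0∞) ≠ 0 := ENNReal.coe_ne_zero.2 (NNReal.rpow_pos hη).ne'
  rcases eq_or_ne g ∞ with rfl | hg
  · rw [add_top, ENNReal.top_rpow_of_pos hθ, ENNReal.mul_top hησ, ENNReal.mul_top hηt]
    exact ⟨η, hη, hη1, le_top, le_top⟩
  lift g to ℝ≥0 using hg
  have hG : 0 < 1 + g := by positivity
  rw [← ENNReal.coe_one, ← ENNReal.coe_add, ← ENNReal.coe_rpow_of_nonneg _ hθ.le]
  norm_cast
  refine ⟨η * (1 + g) ^ (-(1 / (σ + t))), mul_pos hη (NNReal.rpow_pos hG),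
    mul_le_one' hη1 (NNReal.rpow_le_one_of_one_le_of_nonpos le_self_add
      (neg_nonpos.2 (one_div_nonneg.2 hσt.le))), ?_, ?_⟩
  · calc (η * (1 + g) ^ (-(1 / (σ + t)))) ^ σ * g
        ≤ (η * (1 + g) ^ (-(1 / (σ + t)))) ^ σ * (1 + g) := by
          gcongr
          exact le_add_self
      _ = η ^ σ * (1 + g) ^ (t / (σ + t)) := by
          rw [NNReal.mul_rpow, ← NNReal.rpow_mul, mul_assoc, ← NNReal.rpow_add_one hG.ne']
          congr 2
          field_simp
          ring
  · rw [NNReal.mul_rpow, ← NNReal.rpow_mul, neg_mul_neg, one_div_mul_eq_div]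

theorem exists_mul_rpow_le {α : ℝ} (hα : 0 < α) (D : ℝ≥0) {ε : ℝ≥0} (hε : 0 < ε) :
    ∃ η : ℝ≥0, 0 < η ∧ η ≤ 1 ∧ D * η ^ α ≤ ε := by
  have hbase : 0 < ε / (D + 1) := by positivity
  refine ⟨min 1 ((ε / (D + 1)) ^ (1 / α)), lt_min one_pos (NNReal.rpow_pos hbase),
    min_le_left _ _, ?_⟩
  calc D * min 1 ((ε / (D + 1)) ^ (1 / α)) ^ α ≤ (D + 1) * ((ε / (D + 1)) ^ (1 / α)) ^ α := by
        gcongr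
        · exact le_self_add
        · exact min_le_right _ _
    _ = ε := by
        rw [← NNReal.rpow_mul, one_div_mul_cancel hα.ne', NNReal.rpow_one,
          mul_div_cancel₀ _ (by positivity)]

theorem eLpNorm'_le_mul_rpow_of_ae_le_mul_rpow {α F : Type*} [MeasurableSpace α]
    [NormedAddCommGroup F] {μ : Measure α} {f : α → F} {G : α → ℝ≥0∞} {a : ℝ≥0∞} {θ q : ℝ}
    (hq : 0 < q) (hθ : 0 < θ) (hG : AEMeasurable G μ) (h : ∀ᵐ x ∂μ, ‖f x‖ₑ ≤ a * G x ^ θ) :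
    eLpNorm' f q μ ≤ a * eLpNorm' G (θ * q) μ ^ θ := by
  calc eLpNorm' f q μ ≤ (∫⁻ x, (a * G x ^ θ) ^ q ∂μ) ^ (1 / q) := by
        unfold eLpNorm'
        gcongr ?_ ^ _
        refine lintegral_mono_ae (h.mono fun x hx => ?_)
        gcongr
    _ = (a ^ q * ∫⁻ x, G x ^ (θ * q) ∂μ) ^ (1 / q) := by
        simp only [ENNReal.mul_rpow_of_nonneg _ _ hq.le, ← ENNReal.rpow_mul]
        rw [lintegral_const_mul'' _ (hG.pow_const _)]
    _ = a * eLpNorm' G (θ * q) μ ^ θ := by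
        rw [ENNReal.mul_rpow_of_nonneg _ _ (one_div_pos.2 hq).le, one_div,
          ENNReal.rpow_rpow_inv hq.ne', eLpNorm', ← ENNReal.rpow_mul]
        simp only [enorm_eq_self]
        congr 2
        field_simp

variable {X F : Type*} [MetricSpace X] [MeasurableSpace X] [OpensMeasurableSpace X]
  [NormedAddCommGroup F] [NormedSpace ℝ F] {μ : Measure X} [IsFiniteMeasure μ] {S : Set X}
  {d p σ : ℝ} {c : ℝ≥0} {u : X → F}

theorem IsLowerRegularOn.enorm_le_mul_gradient_rpow (h : IsLowerRegularOn μ S d c) (hc : 0 < c)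
    (hd : 0 < d) (hp : 1 ≤ p) (hσ : 0 < σ) (hu : AEStronglyMeasurable u μ) {q : ℝ} (hq : 1 ≤ q)
    {η : ℝ≥0} (hη : 0 < η) (hη1 : η ≤ 1) {x : X} (hx : x ∈ S) :
    ‖u x‖ₑ ≤ ((poincareConst d p σ c * η ^ σ : ℝ≥0) +
        (c ^ (-(1 / q)) * η ^ (-(d / q)) : ℝ≥0) * eLpNorm' u q μ) *
      (1 + gagliardoGradient μ d p σ u x) ^ (d / q / (σ + d / q)) := by
  have ht : 0 < d / q := div_pos hd (one_pos.trans_le hq)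
  set g := gagliardoGradient μ d p σ u x
  obtain ⟨r, hr, hr1, hrσ, hrt⟩ := exists_balancing_radius hσ ht hη hη1 g
  have havg := h.setLAverage_ball_le hc hx hr hr1 hu.enorm hq
  rw [eLpNorm'_enorm] at havg
  calc ‖u x‖ₑ ≤ (poincareConst d p σ c * r ^ σ : ℝ≥0) * g +
        (c ^ (-(1 / q)) * r ^ (-(d / q)) : ℝ≥0) * eLpNorm' u q μ :=
      (h.enorm_le_gradient_add_setLAverage hc hd.le hp hσ.le hu hx hr hr1 (by simp)).trans
        (add_le_add_right havg _)
    _ = poincareConst d p σ c * ((r ^ σ : ℝ≥0) * g) +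
        (c ^ (-(1 / q)) : ℝ≥0) * (r ^ (-(d / q)) : ℝ≥0) * eLpNorm' u q μ := by
      simp only [ENNReal.coe_mul, mul_assoc]
    _ ≤ poincareConst d p σ c * ((η ^ σ : ℝ≥0) * (1 + g) ^ (d / q / (σ + d / q))) +
        (c ^ (-(1 / q)) : ℝ≥0) * ((η ^ (-(d / q)) : ℝ≥0) * (1 + g) ^ (d / q / (σ + d / q))) *
          eLpNorm' u q μ := by
      gcongr
    _ = _ := by
      simp only [ENNReal.coe_mul]
      ring

variable [SecondCountableTopology X]

theorem eLpNorm'_one_add_gagliardoGradient_le (hp : 1 ≤ p) (hu : AEStronglyMeasurable u μ)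
    (hu1 : gagliardoNorm μ d p σ u ≤ 1) :
    eLpNorm' (fun x => 1 + gagliardoGradient μ d p σ u x) p μ ≤ μ univ ^ (1 / p) + 1 := by
  have hadd := eLpNorm'_add_le (f := fun _ : X => (1 : ℝ≥0∞)) aestronglyMeasurable_const
    (aemeasurable_gagliardoGradient (d := d) (p := p) (σ := σ) hu).aestronglyMeasurable hp
  rw [eLpNorm'_const _ (one_pos.trans_le hp), enorm_eq_self, one_mul,
    eLpNorm'_gagliardoGradient hu (one_pos.trans_le hp)] at hadd
  exact hadd.trans (add_le_add_right hu1 _)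

theorem IsLowerRegularOn.ehrling_succ (h : IsLowerRegularOn μ S d c) (hS : ∀ᵐ x ∂μ, x ∈ S)
    (hc : 0 < c) (hd : 0 < d) (hp : 1 ≤ p) (hσ : 0 < σ) {q : ℝ} (hq : 1 ≤ q) :
    Ehrling F μ d p σ (.ofReal q) (.ofReal (p + σ * p / d * q)) := by
  have hp0 : 0 < p := one_pos.trans_le hp
  have hq0 : 0 < q := one_pos.trans_le hq
  set q' := p + σ * p / d * q with hq'
  have hq'0 : 0 < q' := by positivity
  set θ := d / q / (σ + d / q) with hθ
  have hθ0 : 0 < θ := by positivity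
  have hθq : θ * q' = p := by
    rw [hθ, hq']
    field_simp
    ring
  set K : ℝ≥0 := ((μ univ ^ (1 / p) + 1) ^ θ).toNNReal
  have hK : (K : ℝ≥0∞) = (μ univ ^ (1 / p) + 1) ^ θ := ENNReal.coe_toNNReal (by finiteness)
  refine Ehrling.of_normalized hp0 fun ε hε => ?_
  obtain ⟨η, hη, hη1, hηε⟩ := exists_mul_rpow_le hσ (poincareConst d p σ c * K) hε
  refine ⟨c ^ (-(1 / q)) * η ^ (-(d / q)) * K, fun u hu hu1 => ?_⟩
  have hnorm : ∀ {r : ℝ}, 0 < r → eLpNorm u (.ofReal r) μ = eLpNorm' u r μ := fun hr => by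
    rw [eLpNorm_eq_eLpNorm' (by simpa using hr) ENNReal.ofReal_ne_top, ENNReal.toReal_ofReal hr.le]
  have hpt := hS.mono fun x hx => h.enorm_le_mul_gradient_rpow hc hd hp hσ hu hq hη hη1 hx
  rw [hnorm hq'0, hnorm hq0]
  calc eLpNorm' u q' μ ≤ ((poincareConst d p σ c * η ^ σ : ℝ≥0) +
        (c ^ (-(1 / q)) * η ^ (-(d / q)) : ℝ≥0) * eLpNorm' u q μ) *
        eLpNorm' (fun x => 1 + gagliardoGradient μ d p σ u x) (θ * q') μ ^ θ :=
      eLpNorm'_le_mul_rpow_of_ae_le_mul_rpow hq'0 hθ0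
        (aemeasurable_const.add (aemeasurable_gagliardoGradient hu)) hpt
    _ ≤ ((poincareConst d p σ c * η ^ σ : ℝ≥0) +
        (c ^ (-(1 / q)) * η ^ (-(d / q)) : ℝ≥0) * eLpNorm' u q μ) * K := by
      rw [hK, hθq]
      gcongr
      exact eLpNorm'_one_add_gagliardoGradient_le hp hu hu1
    _ = (poincareConst d p σ c * K * η ^ σ : ℝ≥0) +
        (c ^ (-(1 / q)) * η ^ (-(d / q)) * K : ℝ≥0) * eLpNorm' u q μ := by
      simp only [ENNReal.coe_mul]
      ring
    _ ≤ _ := by gcongr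

/-- The iterates of `q ↦ p + (σ p / d) q`, started at `1`, increase to the critical exponent
`d p / (d - σ p)`, which is the fixed point of this map. -/
theorem IsLowerRegularOn.ehrling_of_lt_critical (h : IsLowerRegularOn μ S d c)
    (hS : ∀ᵐ x ∂μ, x ∈ S) (hc : 0 < c) (hd : 0 < d) (hp : 1 ≤ p) (hσ : 0 < σ) (hσp : σ * p < d)
    {q : ℝ≥0∞} (hq0 : q ≠ 0) (hq : q < .ofReal (d * p / (d - σ * p))) :
    Ehrling F μ d p σ 1 q := by
  set P := d * p / (d - σ * p)
  set b := σ * p / d with hb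
  have hp0 : 0 < p := one_pos.trans_le hp
  have hgap : 0 < d - σ * p := sub_pos.2 hσp
  have hb0 : 0 < b := by positivity
  have hb1 : b < 1 := (div_lt_one hd).2 hσp
  have hfix : p + b * P = P := by
    have hPgap : P * (d - σ * p) = d * p := div_mul_cancel₀ _ hgap.ne'
    have hbd : b * d = σ * p := div_mul_cancel₀ _ hd.ne'
    refine mul_left_cancel₀ hd.ne' ?_
    linear_combination P * hbd - hPgap
  have hP1 : 1 ≤ P := (one_le_div hgap).2 (by nlinarith [mul_pos hσ hp0])
  have hiter : ∀ k : ℕ, Ehrling F μ d p σ 1 (.ofReal (P - b ^ k * (P - 1))) := by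
    intro k
    induction k with
    | zero => simpa using Ehrling.refl F μ d p σ 1
    | succ k ih =>
      have hbk : b ^ k ≤ 1 := pow_le_one₀ hb0.le hb1.le
      have hstep := h.ehrling_succ (F := F) hS hc hd hp hσ (q := P - b ^ k * (P - 1))
        (by linarith [mul_le_of_le_one_left (sub_nonneg.2 hP1) hbk])
      convert ih.trans hstep using 2
      rw [← hb, pow_succ]
      linear_combination -hfix
  have hlim : Tendsto (fun k : ℕ => ENNReal.ofReal (P - b ^ k * (P - 1))) atTop
      (𝓝 (.ofReal P)) := by
    refine ENNReal.tendsto_ofReal ?_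
    simpa using tendsto_const_nhds.sub
      ((tendsto_pow_atTop_nhds_zero_of_lt_one hb0.le hb1).mul_const (P - 1))
  obtain ⟨k, hk⟩ := (hlim.eventually_const_lt hq).exists
  exact (hiter k).trans (Ehrling.of_le hq0 hk.le)

end Subcritical

section Supercritical

theorem setLAverage_add_const {α : Type*} [MeasurableSpace α] {ν : Measure α}
    (s : Set α) (f : α → ℝ≥0∞) (a : ℝ≥0∞) :
    ⨍⁻ x in s, (f x + a) ∂ν ≤ ⨍⁻ x in s, f x ∂ν + a := by
  rw [setLAverage_eq, setLAverage_eq, lintegral_add_right _ measurable_const, setLIntegral_const,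
    ENNReal.add_div]
  gcongr
  exact ENNReal.div_le_of_le_mul le_rfl

theorem exists_add_rpow_half_eq {α : ℝ} (hα : 0 < α) (D : ℝ≥0) :
    ∃ L : ℝ≥0, ∀ r : ℝ≥0, D * r ^ α + L * (r / 2) ^ α = L * r ^ α := by
  have hρ : (2 : ℝ≥0)⁻¹ ^ α < 1 := NNReal.rpow_lt_one (by norm_num) hα
  refine ⟨D / (1 - 2⁻¹ ^ α), fun r => ?_⟩
  have hgap : 1 - (2 : ℝ≥0)⁻¹ ^ α ≠ 0 := (tsub_pos_of_lt hρ).ne'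
  calc D * r ^ α + D / (1 - 2⁻¹ ^ α) * (r / 2) ^ α
      = D / (1 - 2⁻¹ ^ α) * ((1 - 2⁻¹ ^ α) + 2⁻¹ ^ α) * r ^ α := by
        rw [mul_add, div_mul_cancel₀ _ hgap, div_eq_mul_inv r, NNReal.mul_rpow]
        ring
    _ = _ := by rw [tsub_add_cancel_of_le hρ.le, mul_one]

variable {X F : Type*} [MetricSpace X] [MeasurableSpace X] [OpensMeasurableSpace X]
  [SecondCountableTopology X] [NormedAddCommGroup F] [NormedSpace ℝ F] {μ : Measure X}
  [IsFiniteMeasure μ] {S : Set X} {d p σ : ℝ} {c : ℝ≥0} {u : X → F}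

theorem IsLowerRegularOn.setLAverage_half_le (h : IsLowerRegularOn μ S d c) (hc : 0 < c)
    (hd : 0 ≤ d) (hp : 1 ≤ p) (hσ : 0 ≤ σ) (hu : AEStronglyMeasurable u μ) {x : X} (hx : x ∈ S)
    {r : ℝ≥0} (hr : 0 < r) (hr1 : r ≤ 1) :
    ⨍⁻ z in ball x (r / 2 : ℝ≥0), ‖u z‖ₑ ∂μ ≤ ⨍⁻ z in ball x r, ‖u z‖ₑ ∂μ +
      (poincareConst d p σ c * c ^ (-(1 / p)) * 2 ^ (d / p) * r ^ (σ - d / p) : ℝ≥0) *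
        gagliardoNorm μ d p σ u := by
  have hr2 : r / 2 ≤ r := half_le_self r.2
  have hmean := h.setLAverage_ball_le hc hx (half_pos hr) (hr2.trans hr1)
    (aemeasurable_gagliardoGradient (d := d) (p := p) (σ := σ) hu) hp
  rw [eLpNorm'_gagliardoGradient hu (one_pos.trans_le hp)] at hmean
  calc ⨍⁻ z in ball x (r / 2 : ℝ≥0), ‖u z‖ₑ ∂μ
      ≤ ⨍⁻ z in ball x (r / 2 : ℝ≥0), ((poincareConst d p σ c * r ^ σ : ℝ≥0) *
          gagliardoGradient μ d p σ u z + ⨍⁻ z in ball x r, ‖u z‖ₑ ∂μ) ∂μ :=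
        laverage_mono_ae (ae_restrict_of_forall_mem measurableSet_ball fun z hz =>
          h.enorm_le_gradient_add_setLAverage hc hd hp hσ hu hx hr hr1
            ((mem_ball.1 hz).le.trans hr2))
    _ ≤ (poincareConst d p σ c * r ^ σ : ℝ≥0) *
          ⨍⁻ z in ball x (r / 2 : ℝ≥0), gagliardoGradient μ d p σ u z ∂μ +
          ⨍⁻ z in ball x r, ‖u z‖ₑ ∂μ := by
        refine (setLAverage_add_const _ _ _).trans_eq ?_
        rw [setLAverage_eq, setLAverage_eq _ _ (ball x (r / 2 : ℝ≥0)),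
          lintegral_const_mul' _ _ ENNReal.coe_ne_top, mul_div_assoc]
    _ ≤ (poincareConst d p σ c * r ^ σ : ℝ≥0) *
          ((c ^ (-(1 / p)) * (r / 2) ^ (-(d / p)) : ℝ≥0) * gagliardoNorm μ d p σ u) +
          ⨍⁻ z in ball x r, ‖u z‖ₑ ∂μ := by gcongr
    _ = _ := by
        rw [add_comm, ← mul_assoc, ← ENNReal.coe_mul, NNReal.div_rpow, NNReal.rpow_sub hr.ne',
          NNReal.rpow_neg r, NNReal.rpow_neg 2]
        have hrd : r ^ (d / p) ≠ 0 := (NNReal.rpow_pos hr).ne'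
        congr 3
        field_simp

theorem ae_gagliardoGradient_lt_top (hp : 0 < p) (hu : AEStronglyMeasurable u μ)
    (hG : gagliardoNorm μ d p σ u ≠ ∞) : ∀ᵐ x ∂μ, gagliardoGradient μ d p σ u x < ∞ := by
  have hint : ∫⁻ x, gagliardoGradient μ d p σ u x ^ p ∂μ ≠ ∞ := by
    rw [← eLpNorm'_gagliardoGradient hu hp] at hG
    exact (lintegral_rpow_enorm_lt_top_of_eLpNorm'_lt_top hp hG.lt_top).ne
  filter_upwards [ae_lt_top' ((aemeasurable_gagliardoGradient hu).pow_const p) hint] with x hx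
  exact (ENNReal.rpow_lt_top_iff_of_pos hp).1 hx

/-- By the choice of `L` the right-hand side does not increase when `r` is halved, and
at every point where the gradient is finite the averages dominate `‖u x‖ₑ` in the limit. -/
theorem IsLowerRegularOn.enorm_le_setLAverage_add (h : IsLowerRegularOn μ S d c) (hc : 0 < c)
    (hd : 0 ≤ d) (hp : 1 ≤ p) (hσ : 0 < σ) {L : ℝ≥0}
    (hL : ∀ r : ℝ≥0, poincareConst d p σ c * c ^ (-(1 / p)) * 2 ^ (d / p) * r ^ (σ - d / p) +
      L * (r / 2) ^ (σ - d / p) = L * r ^ (σ - d / p))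
    (hu : AEStronglyMeasurable u μ) {r : ℝ≥0} (hr : 0 < r) (hr1 : r ≤ 1) {x : X} (hx : x ∈ S)
    (hgx : gagliardoGradient μ d p σ u x < ∞) :
    ‖u x‖ₑ ≤ ⨍⁻ z in ball x r, ‖u z‖ₑ ∂μ +
      (L * r ^ (σ - d / p) : ℝ≥0) * gagliardoNorm μ d p σ u := by
  set G := gagliardoNorm μ d p σ u
  have hradius : ∀ k : ℕ, 0 < r * 2⁻¹ ^ k ∧ r * 2⁻¹ ^ k ≤ 1 := fun k =>
    ⟨by positivity, mul_le_one' hr1 (pow_le_one₀ (by positivity) (by norm_num))⟩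
  have hanti : Antitone fun k : ℕ => ⨍⁻ z in ball x (r * 2⁻¹ ^ k : ℝ≥0), ‖u z‖ₑ ∂μ +
      (L * (r * 2⁻¹ ^ k) ^ (σ - d / p) : ℝ≥0) * G := by
    refine antitone_nat_of_succ_le fun k => ?_
    have hhalf : r * 2⁻¹ ^ (k + 1) = r * 2⁻¹ ^ k / 2 := by rw [pow_succ, ← mul_assoc]; rfl
    rw [hhalf, ← hL (r * 2⁻¹ ^ k), ENNReal.coe_add, add_mul, ← add_assoc]
    gcongr
    exact h.setLAverage_half_le hc hd hp hσ.le hu hx (hradius k).1 (hradius k).2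
  have hbound : ∀ k : ℕ, ‖u x‖ₑ ≤ (poincareConst d p σ c * (r * 2⁻¹ ^ k) ^ σ : ℝ≥0) *
      gagliardoGradient μ d p σ u x +
        (⨍⁻ z in ball x r, ‖u z‖ₑ ∂μ + (L * r ^ (σ - d / p) : ℝ≥0) * G) := by
    intro k
    refine (h.enorm_le_gradient_add_setLAverage hc hd hp hσ.le hu hx (hradius k).1 (hradius k).2
      (by simp)).trans ?_
    gcongr
    simpa using le_self_add.trans (hanti (Nat.zero_le k))
  have hlim : Tendsto (fun k : ℕ => poincareConst d p σ c * (r * 2⁻¹ ^ k) ^ σ) atTop (𝓝 0) := by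
    have hpow := (tendsto_pow_atTop_nhds_zero_of_lt_one (r := (2⁻¹ : ℝ≥0)) (by positivity)
      (by norm_num)).const_mul r
    simpa [NNReal.zero_rpow hσ.ne'] using (hpow.nnrpow tendsto_const_nhds
      (.inr hσ)).const_mul (poincareConst d p σ c)
  have hlim' := (ENNReal.Tendsto.mul_const (ENNReal.tendsto_coe.2 hlim) (.inr hgx.ne)).add_const
    (⨍⁻ z in ball x r, ‖u z‖ₑ ∂μ + (L * r ^ (σ - d / p) : ℝ≥0) * G)
  rw [ENNReal.coe_zero, zero_mul, zero_add] at hlim'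
  exact ge_of_tendsto' hlim' hbound

theorem IsLowerRegularOn.ehrling_top (h : IsLowerRegularOn μ S d c) (hS : ∀ᵐ x ∂μ, x ∈ S)
    (hc : 0 < c) (hd : 0 ≤ d) (hp : 1 ≤ p) (hσ : 0 < σ) (hσp : d < σ * p) :
    Ehrling F μ d p σ 1 ∞ := by
  have hp0 : 0 < p := one_pos.trans_le hp
  have hα : 0 < σ - d / p := sub_pos.2 ((div_lt_iff₀ hp0).2 hσp)
  obtain ⟨L, hL⟩ := exists_add_rpow_half_eq hα
    (poincareConst d p σ c * c ^ (-(1 / p)) * 2 ^ (d / p))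
  refine Ehrling.of_normalized hp0 fun ε hε => ?_
  obtain ⟨r, hr, hr1, hrε⟩ := exists_mul_rpow_le hα L hε
  refine ⟨c ^ (-(1 / 1 : ℝ)) * r ^ (-(d / 1)), fun u hu hu1 => ?_⟩
  rw [eLpNorm_exponent_top, eLpNorm_eq_eLpNorm' one_ne_zero ENNReal.one_ne_top, ENNReal.toReal_one]
  refine essSup_le_of_ae_le _ ?_
  filter_upwards [hS, ae_gagliardoGradient_lt_top hp0 hu
    (ne_top_of_le_ne_top ENNReal.one_ne_top hu1)] with x hx hgx
  have havg := h.setLAverage_ball_le hc hx hr hr1 hu.enorm le_rfl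
  rw [eLpNorm'_enorm] at havg
  calc ‖u x‖ₑ ≤ ⨍⁻ z in ball x r, ‖u z‖ₑ ∂μ +
        (L * r ^ (σ - d / p) : ℝ≥0) * gagliardoNorm μ d p σ u :=
      h.enorm_le_setLAverage_add hc hd hp hσ hL hu hr hr1 hx hgx
    _ ≤ (c ^ (-(1 / 1 : ℝ)) * r ^ (-(d / 1)) : ℝ≥0) * eLpNorm' u 1 μ + ε * 1 := by gcongr
    _ = _ := by rw [mul_one, add_comm]

theorem IsLowerRegularOn.exists_ehrling_of_le_critical (h : IsLowerRegularOn μ S d c)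
    (hS : ∀ᵐ x ∂μ, x ∈ S) (hc : 0 < c) (hd : 0 < d) (hp : 1 ≤ p) {s s' : ℝ} (hs' : 0 < s')
    (hs : s' < s) {q : ℝ≥0∞} (hq0 : q ≠ 0)
    (hq : s' * p < d → q ≤ .ofReal (d * p / (d - s' * p))) :
    ∃ σ, 0 < σ ∧ σ < s ∧ Ehrling F μ d p σ 1 q := by
  have hp0 : 0 < p := one_pos.trans_le hp
  rcases lt_or_ge (s' * p) d with hlt | hge
  · obtain ⟨σ, hσs', hσ⟩ := exists_between (lt_min hs ((lt_div_iff₀ hp0).2 hlt))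
    have hσp : σ * p < d := (lt_div_iff₀ hp0).1 (hσ.trans_le (min_le_right _ _))
    refine ⟨σ, hs'.trans hσs', hσ.trans_le (min_le_left _ _), h.ehrling_of_lt_critical hS hc hd hp
      (hs'.trans hσs') hσp hq0 ((hq hlt).trans_lt ?_)⟩
    have hgap : d - σ * p < d - s' * p := by gcongr
    have hcrit : d * p / (d - s' * p) < d * p / (d - σ * p) :=
      div_lt_div_of_pos_left (by positivity) (sub_pos.2 hσp) hgap
    exact (ENNReal.ofReal_lt_ofReal_iff_of_nonneg
      (div_nonneg (by positivity) (sub_pos.2 hlt).le)).2 hcrit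
  · obtain ⟨σ, hσs', hσs⟩ := exists_between hs
    have hσp : d < σ * p := hge.trans_lt (by gcongr)
    exact ⟨σ, hs'.trans hσs', hσs, (h.ehrling_top hS hc hd.le hp (hs'.trans hσs') hσp).trans
      (Ehrling.of_le hq0 le_top)⟩

end Supercritical

section Compactness

theorem exists_subseq_tendsto_of_isBounded {ι F : Type*} [Countable ι] [NormedAddCommGroup F]
    [ProperSpace F]
    {A : ℕ → ι → F} (hA : ∀ i, Bornology.IsBounded (range fun n => A n i)) :
    ∃ k : ℕ → ℕ, StrictMono k ∧
      ∀ i, Tendsto (fun z : ℕ × ℕ => A (k z.1) i - A (k z.2) i) atTop (𝓝 0) := by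
  obtain ⟨L, -, k, hk, hlim⟩ := (isCompact_univ_pi fun i => (hA i).isCompact_closure).tendsto_subseq
    (x := A) fun n i _ => subset_closure ⟨n, rfl⟩
  refine ⟨k, hk, fun i => ?_⟩
  have hi := tendsto_pi_nhds.1 hlim i
  have hpair := (hi.comp tendsto_fst).sub (hi.comp tendsto_snd)
  rwa [sub_self, prod_atTop_atTop_eq] at hpair

theorem exists_tendsto_eLpNorm_of_cauchy {α F : Type*} [MeasurableSpace α] {μ : Measure α}
    [NormedAddCommGroup F] [CompleteSpace F] {q : ℝ≥0∞} (hq : 1 ≤ q) {u : ℕ → α → F}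
    (hu : ∀ n, MemLp (u n) q μ)
    (hcau : Tendsto (fun z : ℕ × ℕ => eLpNorm (u z.1 - u z.2) q μ) atTop (𝓝 0)) :
    ∃ v, MemLp v q μ ∧ Tendsto (fun n => eLpNorm (u n - v) q μ) atTop (𝓝 0) := by
  have : Fact (1 ≤ q) := ⟨hq⟩
  have hseq : CauchySeq fun n => (hu n).toLp := by
    refine (Lp.cauchySeq_Lp_iff_cauchySeq_eLpNorm _).2 (hcau.congr fun z => ?_)
    exact eLpNorm_congr_ae ((hu z.1).coeFn_toLp.sub (hu z.2).coeFn_toLp).symm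
  obtain ⟨v, hv⟩ := cauchySeq_tendsto_of_complete hseq
  exact ⟨v, Lp.memLp v, (Lp.tendsto_Lp_iff_tendsto_eLpNorm'' u hu v (Lp.memLp v)).1
    (by rwa [Lp.toLp_coeFn])⟩

variable {X F : Type*} [MetricSpace X] [MeasurableSpace X] [NormedAddCommGroup F]
  [NormedSpace ℝ F] {μ : Measure X} {S : Set X} {d p σ : ℝ} {c : ℝ≥0}

theorem IsLowerRegularOn.isBounded_range_setAverage (h : IsLowerRegularOn μ S d c) (hc : 0 < c)
    {u : ℕ → X → F} {K : ℝ≥0} (hu : ∀ n, AEStronglyMeasurable (u n) μ)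
    (hu1 : ∀ n, eLpNorm (u n) 1 μ ≤ K) {y : X} (hy : y ∈ S) {r : ℝ≥0} (hr : 0 < r) (hr1 : r ≤ 1) :
    Bornology.IsBounded (range fun n => ⨍ z in ball y r, u n z ∂μ) := by
  refine isBounded_iff_forall_norm_le.2 ⟨c ^ (-(1 / 1 : ℝ)) * r ^ (-(d / 1)) * K, ?_⟩
  rintro _ ⟨n, rfl⟩
  have hle : ‖⨍ z in ball y r, u n z ∂μ‖ₑ ≤
      (c ^ (-(1 / 1 : ℝ)) * r ^ (-(d / 1)) * K : ℝ≥0) :=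
    calc ‖⨍ z in ball y r, u n z ∂μ‖ₑ ≤ ⨍⁻ z in ball y r, ‖u n z‖ₑ ∂μ :=
          enorm_integral_le_lintegral_enorm _
      _ ≤ (c ^ (-(1 / 1 : ℝ)) * r ^ (-(d / 1)) : ℝ≥0) * eLpNorm (u n) 1 μ := by
          have havg := h.setLAverage_ball_le hc hy hr hr1 (hu n).enorm le_rfl
          rwa [eLpNorm'_enorm, ← ENNReal.toReal_one,
            ← eLpNorm_eq_eLpNorm' one_ne_zero ENNReal.one_ne_top, ENNReal.toReal_one] at havg
      _ ≤ _ := by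
          rw [ENNReal.coe_mul _ K]
          gcongr
          exact hu1 n
  exact_mod_cast enorm_le_coe.1 hle

theorem enorm_sub_average_le {α : Type*} [MeasurableSpace α] {ν : Measure α} [IsFiniteMeasure ν]
    [NeZero ν] [CompleteSpace F] {f : α → F} (hf : Integrable f ν) (a : F) :
    ‖a - ⨍ x, f x ∂ν‖ₑ ≤ ⨍⁻ x, ‖a - f x‖ₑ ∂ν := by
  have hsub : a - ⨍ x, f x ∂ν = ⨍ x, (a - f x) ∂ν := by
    rw [average, average, integral_sub (integrable_const a) hf.to_average, integral_const]
    simp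
  rw [hsub]
  exact enorm_integral_le_lintegral_enorm _

variable [OpensMeasurableSpace X] [SecondCountableTopology X] [IsFiniteMeasure μ]

theorem IsLowerRegularOn.eLpNorm_one_le_of_cover [CompleteSpace F] (h : IsLowerRegularOn μ S d c)
    (hc : 0 < c) (hd : 0 ≤ d) (hp : 1 ≤ p) (hσ : 0 ≤ σ) {u : X → F} (hu : Integrable u μ)
    {r : ℝ≥0} (hr : 0 < r) (hr1 : r ≤ 1) {t : Finset X} (htS : ↑t ⊆ S)
    (hcover : ∀ᵐ x ∂μ, ∃ y ∈ t, dist x y ≤ r) :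
    eLpNorm u 1 μ ≤ (poincareConst d p σ c * r ^ σ : ℝ≥0) *
        (gagliardoNorm μ d p σ u * μ univ ^ (1 - 1 / p)) +
      μ univ * ∑ y ∈ t, ‖⨍ z in ball y r, u z ∂μ‖ₑ := by
  have hpt : ∀ᵐ x ∂μ, ‖u x‖ₑ ≤ (poincareConst d p σ c * r ^ σ : ℝ≥0) *
      gagliardoGradient μ d p σ u x + ∑ y ∈ t, ‖⨍ z in ball y r, u z ∂μ‖ₑ := by
    filter_upwards [hcover] with x ⟨y, hyt, hxy⟩
    have : NeZero (μ.restrict (ball y r)) :=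
      ⟨Measure.restrict_eq_zero.not.2 (h.measure_ball_pos hc (htS hyt) hr hr1).ne'⟩
    calc ‖u x‖ₑ = ‖(u x - ⨍ z in ball y r, u z ∂μ) + ⨍ z in ball y r, u z ∂μ‖ₑ := by
          rw [sub_add_cancel]
      _ ≤ ⨍⁻ z in ball y r, ‖u x - u z‖ₑ ∂μ + ‖⨍ z in ball y r, u z ∂μ‖ₑ :=
          (enorm_add_le _ _).trans (by gcongr; exact enorm_sub_average_le hu.restrict _)
      _ ≤ _ := add_le_add
          (h.setLAverage_enorm_sub_le hc hd hp hσ hu.aestronglyMeasurable (htS hyt) hr hr1 hxy)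
          (Finset.single_le_sum (f := fun y => ‖⨍ z in ball y r, u z ∂μ‖ₑ)
            (fun _ _ => zero_le) hyt)
  have hgrad := aemeasurable_gagliardoGradient (d := d) (p := p) (σ := σ) hu.aestronglyMeasurable
  have hgrad1 : ∫⁻ x, gagliardoGradient μ d p σ u x ∂μ ≤
      gagliardoNorm μ d p σ u * μ univ ^ (1 - 1 / p) := by
    have hle := eLpNorm'_le_eLpNorm'_mul_rpow_measure_univ one_pos hp hgrad.aestronglyMeasurable
    rw [eLpNorm'_gagliardoGradient hu.aestronglyMeasurable (one_pos.trans_le hp)] at hle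
    simpa [eLpNorm'] using hle
  calc eLpNorm u 1 μ ≤ ∫⁻ x, ((poincareConst d p σ c * r ^ σ : ℝ≥0) *
        gagliardoGradient μ d p σ u x + ∑ y ∈ t, ‖⨍ z in ball y r, u z ∂μ‖ₑ) ∂μ := by
        rw [eLpNorm_one_eq_lintegral_enorm]
        exact lintegral_mono_ae hpt
    _ = (poincareConst d p σ c * r ^ σ : ℝ≥0) * ∫⁻ x, gagliardoGradient μ d p σ u x ∂μ +
        μ univ * ∑ y ∈ t, ‖⨍ z in ball y r, u z ∂μ‖ₑ := by
        rw [lintegral_add_right _ measurable_const, lintegral_const_mul' _ _ ENNReal.coe_ne_top,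
          lintegral_const, mul_comm (μ univ)]
    _ ≤ _ := by gcongr

theorem IsLowerRegularOn.exists_eLpNorm_one_le_add_average [CompleteSpace F]
    (h : IsLowerRegularOn μ S d c) (hS : ∀ᵐ x ∂μ, x ∈ S) (hStb : TotallyBounded S) (hc : 0 < c)
    (hd : 0 ≤ d) (hp : 1 ≤ p) (hσ : 0 < σ) (K : ℝ≥0) {ε : ℝ≥0} (hε : 0 < ε) :
    ∃ (r : ℝ≥0) (t : Finset X), 0 < r ∧ r ≤ 1 ∧ ↑t ⊆ S ∧ ∀ w : X → F, Integrable w μ →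
      gagliardoNorm μ d p σ w ≤ K →
        eLpNorm w 1 μ ≤ ε + μ univ * ∑ y ∈ t, ‖⨍ z in ball y r, w z ∂μ‖ₑ := by
  have hexp : 0 ≤ 1 - 1 / p := sub_nonneg.2 ((div_le_one (one_pos.trans_le hp)).2 hp)
  set M : ℝ≥0 := (μ univ ^ (1 - 1 / p)).toNNReal
  have hM : (M : ℝ≥0∞) = μ univ ^ (1 - 1 / p) := ENNReal.coe_toNNReal (by finiteness)
  obtain ⟨r, hr, hr1, hrε⟩ := exists_mul_rpow_le hσ (poincareConst d p σ c * (K * M)) hε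
  obtain ⟨t, htS, htfin, hcover⟩ := finite_approx_of_totallyBounded hStb r hr
  lift t to Finset X using htfin
  refine ⟨r, t, hr, hr1, htS, fun w hw hwK => ?_⟩
  have hcoverμ : ∀ᵐ x ∂μ, ∃ y ∈ t, dist x y ≤ r := hS.mono fun x hx => by
    obtain ⟨y, hyt, hxy⟩ := mem_iUnion₂.1 (hcover hx)
    exact ⟨y, hyt, (mem_ball.1 hxy).le⟩
  refine (h.eLpNorm_one_le_of_cover hc hd hp hσ.le hw hr hr1 htS hcoverμ).trans ?_
  gcongr
  calc (poincareConst d p σ c * r ^ σ : ℝ≥0) * (gagliardoNorm μ d p σ w * μ univ ^ (1 - 1 / p))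
      ≤ (poincareConst d p σ c * r ^ σ : ℝ≥0) * (K * M) := by rw [hM]; gcongr
    _ = (poincareConst d p σ c * (K * M) * r ^ σ : ℝ≥0) := by push_cast; ring
    _ ≤ ε := ENNReal.coe_le_coe.2 hrε

theorem IsLowerRegularOn.exists_subseq_tendsto_eLpNorm_one [ProperSpace F]
    (h : IsLowerRegularOn μ S d c) (hS : ∀ᵐ x ∂μ, x ∈ S) (hStb : TotallyBounded S) (hc : 0 < c)
    (hd : 0 ≤ d) (hp : 1 ≤ p) (hσ : 0 < σ) {u : ℕ → X → F} {K : ℝ≥0}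
    (hu : ∀ n, AEStronglyMeasurable (u n) μ) (hu1 : ∀ n, eLpNorm (u n) 1 μ ≤ K)
    (huG : ∀ n m, gagliardoNorm μ d p σ (u n - u m) ≤ K) :
    ∃ k : ℕ → ℕ, StrictMono k ∧
      Tendsto (fun z : ℕ × ℕ => eLpNorm (u (k z.1) - u (k z.2)) 1 μ) atTop (𝓝 0) := by
  have hint : ∀ n, Integrable (u n) μ := fun n =>
    memLp_one_iff_integrable.1 ⟨hu n, (hu1 n).trans_lt ENNReal.coe_lt_top⟩
  choose r t hr hr1 htS hbound using fun j : ℕ =>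
    h.exists_eLpNorm_one_le_add_average (F := F) hS hStb hc hd hp hσ K
      (ε := 1 / ((j : ℝ≥0) + 1)) (by positivity)
  let A : ℕ → (Σ j, t j) → F := fun n i => ⨍ z in ball i.2 (r i.1), u n z ∂μ
  obtain ⟨k, hk, hA⟩ := exists_subseq_tendsto_of_isBounded (A := A) fun i =>
    h.isBounded_range_setAverage hc hu hu1 (htS i.1 i.2.2) (hr i.1) (hr1 i.1)
  have havg : ∀ j, Tendsto (fun z : ℕ × ℕ => μ univ *
      ∑ y ∈ t j, ‖⨍ x in ball y (r j), (u (k z.1) - u (k z.2)) x ∂μ‖ₑ) atTop (𝓝 0) := by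
    intro j
    have hsum : Tendsto (fun z : ℕ × ℕ =>
        ∑ y : t j, ‖A (k z.1) ⟨j, y⟩ - A (k z.2) ⟨j, y⟩‖ₑ) atTop (𝓝 (∑ _y : t j, ‖(0 : F)‖ₑ)) :=
      tendsto_finsetSum _ fun y _ => (hA ⟨j, y⟩).enorm
    simp only [enorm_zero, Finset.sum_const_zero] at hsum
    have hmul := ENNReal.Tendsto.const_mul hsum (.inr (measure_ne_top μ univ))
    rw [mul_zero] at hmul
    refine hmul.congr fun z => ?_
    congr 1
    rw [← Finset.sum_coe_sort (t j) fun y =>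
      ‖⨍ x in ball y (r j), (u (k z.1) - u (k z.2)) x ∂μ‖ₑ]
    refine Finset.sum_congr rfl fun y _ => congrArg (fun v : F => ‖v‖ₑ) ?_
    exact (integral_sub (hint _).restrict.to_average (hint _).restrict.to_average).symm
  refine ⟨k, hk, ENNReal.tendsto_nhds_zero.2 fun ε hε => ?_⟩
  obtain ⟨δ, hδ, hδε⟩ := ENNReal.lt_iff_exists_nnreal_btwn.1 hε
  obtain ⟨j, hj⟩ := exists_nat_one_div_lt (half_pos (ENNReal.coe_pos.1 hδ))
  have hδ2 : (0 : ℝ≥0∞) < (δ / 2 : ℝ≥0) := ENNReal.coe_pos.2 (half_pos (ENNReal.coe_pos.1 hδ))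
  filter_upwards [(havg j).eventually_le_const hδ2] with z hz
  calc eLpNorm (u (k z.1) - u (k z.2)) 1 μ ≤ (δ / 2 : ℝ≥0) + (δ / 2 : ℝ≥0) :=
        (hbound j _ ((hint _).sub (hint _)) (huG _ _)).trans
          (add_le_add (ENNReal.coe_le_coe.2 hj.le) hz)
    _ = δ := by rw [← ENNReal.coe_add, add_halves]
    _ ≤ ε := hδε.le

theorem IsLowerRegularOn.exists_subseq_tendsto_eLpNorm [ProperSpace F]
    (h : IsLowerRegularOn μ S d c) (hS : ∀ᵐ x ∂μ, x ∈ S) (hStb : TotallyBounded S) (hc : 0 < c)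
    (hd : 0 ≤ d) (hp : 1 ≤ p) (hσ : 0 < σ) {q : ℝ≥0∞} (hq : 1 ≤ q) (hE : Ehrling F μ d p σ 1 q)
    {u : ℕ → X → F} {K : ℝ≥0} (hu : ∀ n, MemLp (u n) q μ) (hu1 : ∀ n, eLpNorm (u n) 1 μ ≤ K)
    (huG : ∀ n, gagliardoNorm μ d p σ (u n) ≤ K) :
    ∃ (v : X → F) (k : ℕ → ℕ), MemLp v q μ ∧ StrictMono k ∧
      Tendsto (fun n => eLpNorm (u (k n) - v) q μ) atTop (𝓝 0) := by
  have huG' : ∀ n m, gagliardoNorm μ d p σ (u n - u m) ≤ (K + K : ℝ≥0) := fun n m =>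
    (gagliardoNorm_sub_le (hu n).1 (hu m).1 hp).trans (add_le_add (huG n) (huG m))
  obtain ⟨k, hk, hcau⟩ := h.exists_subseq_tendsto_eLpNorm_one hS hStb hc hd hp hσ
    (fun n => (hu n).1) (fun n => (hu1 n).trans (ENNReal.coe_le_coe.2 le_self_add)) huG'
  obtain ⟨v, hv, hlim⟩ := exists_tendsto_eLpNorm_of_cauchy hq (fun n => hu (k n))
    (hE.tendsto_eLpNorm (fun _ => (hu _).1.sub (hu _).1) (fun _ => huG' _ _) hcau)
  exact ⟨v, k, hv, hk, hlim⟩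

end Compactness

section Corkscrew

/-- The interior corkscrew condition for `Ω` at the points of `S`: at all scales `r ≤ δ`, the set
`Ω` contains a ball of radius `ε r` inside the ball of radius `r` about the point. -/
def IsCorkscrewOn {X : Type*} [PseudoMetricSpace X] (Ω S : Set X) (ε δ : ℝ) : Prop :=
  ∀ x ∈ S, ∀ r, 0 < r → r ≤ δ → ∃ y, ball y (ε * r) ⊆ Ω ∩ ball x r

variable {X Y : Type*} [PseudoMetricSpace X] [PseudoMetricSpace Y] {Ω : Set Y} {ε : ℝ}

theorem exists_isCorkscrewOn_ball (hΩ : IsOpen Ω) (hε1 : ε ≤ 1) {x₀ : Y} (hx₀ : x₀ ∈ Ω) :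
    ∃ δ > 0, IsCorkscrewOn Ω (ball x₀ δ) ε δ := by
  obtain ⟨ρ, hρ, hball⟩ := Metric.isOpen_iff.1 hΩ x₀ hx₀
  refine ⟨ρ / 2, half_pos hρ, fun x hx r hr hrδ => ⟨x, ?_⟩⟩
  have hεr : ball x (ε * r) ⊆ ball x r := ball_subset_ball (mul_le_of_le_one_left hr.le hε1)
  refine subset_inter (hεr.trans ((ball_subset_ball' ?_).trans hball)) hεr
  linarith [mem_ball.1 hx]

theorem IsCorkscrewOn.exists_of_chart {P A : Set X} (hP : IsCorkscrewOn P P ε 1) (hε : 0 < ε)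
    (hε1 : ε ≤ 1) (hPA : P ⊆ A) {U : Set Y} (hU : IsOpen U) {T : X → Y} {T' : Y → X}
    (hinv : InvOn T' T A U) (hTA : T '' A ⊆ U) {M : ℝ≥0} (hM : 1 ≤ M) (hT : LipschitzOnWith M T A)
    (hT' : LipschitzOnWith M T' U) (hTP : T '' P = U ∩ Ω) {x₀ : Y} (hx₀ : x₀ ∈ U) :
    ∃ δ > 0, IsCorkscrewOn Ω (ball x₀ δ ∩ Ω) (ε / M ^ 2) δ := by
  obtain ⟨ρ, hρ, hball⟩ := Metric.isOpen_iff.1 hU x₀ hx₀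
  have hM1 : (1 : ℝ) ≤ M := hM
  have hM0 : (0 : ℝ) < M := one_pos.trans_le hM1
  have hcontract : ∀ {x z : X} {r : ℝ}, x ∈ A → z ∈ A → dist x z < r / M → dist (T x) (T z) < r :=
    fun hx hz hxz => (hT.dist_le_mul _ hx _ hz).trans_lt ((lt_div_iff₀' hM0).1 hxz)
  refine ⟨min (ρ / 3) 1, by positivity, fun x ⟨hxball, hxΩ⟩ r hr hrδ => ?_⟩
  obtain ⟨hrρ, hr1⟩ := le_min_iff.1 hrδ
  have hxx₀ : dist x x₀ < ρ / 3 := hxball.trans_le (min_le_left _ _)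
  obtain ⟨z, hz, rfl⟩ : x ∈ T '' P := hTP ▸ ⟨hball (hxx₀.trans (by linarith)), hxΩ⟩
  obtain ⟨w, hw⟩ := hP z hz (r / M) (by positivity)
    ((div_le_self hr.le hM1).trans hr1)
  obtain ⟨hwP, hwz⟩ := hw (mem_ball_self (by positivity))
  have hTwz : dist (T w) (T z) < r := hcontract (hPA hwP) (hPA hz) hwz
  refine ⟨T w, fun y hy => ?_⟩
  have hyU : y ∈ U := by
    have hεr : ε / M ^ 2 * r ≤ r :=
      mul_le_of_le_one_left hr.le (div_le_one_of_le₀ (hε1.trans (one_le_pow₀ hM1)) (by positivity))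
    refine hball (mem_ball.2 ?_)
    linarith [mem_ball.1 hy, dist_triangle4 y (T w) (T z) x₀]
  have hyw : T' y ∈ ball w (ε * (r / M)) := by
    have hdist := hT'.dist_le_mul y hyU (T w) (hTA (mem_image_of_mem T (hPA hwP)))
    rw [hinv.1 (hPA hwP)] at hdist
    calc dist (T' y) w ≤ M * dist y (T w) := hdist
      _ < M * (ε / M ^ 2 * r) := by gcongr; exact hy
      _ = ε * (r / M) := by field_simp
  obtain ⟨hyP, hyz⟩ := hw hyw
  have hyT : T (T' y) = y := hinv.2 hyU
  have hyUΩ : T (T' y) ∈ U ∩ Ω := hTP ▸ mem_image_of_mem T hyP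
  exact ⟨hyT ▸ hyUΩ.2, hyT ▸ hcontract (hPA hyP) (hPA hz) hyz⟩

theorem exists_isCorkscrewOn_of_isCompact_closure (hΩ : IsCompact (closure Ω))
    (hloc : ∀ x₀ ∈ closure Ω, ∃ δ > 0, IsCorkscrewOn Ω (ball x₀ δ ∩ Ω) ε δ) :
    ∃ δ > 0, IsCorkscrewOn Ω Ω ε δ := by
  suffices h : ∃ δ > 0, IsCorkscrewOn Ω (closure Ω ∩ Ω) ε δ by
    rwa [inter_eq_self_of_subset_right subset_closure] at h
  refine hΩ.induction_on (p := fun S => ∃ δ > 0, IsCorkscrewOn Ω (S ∩ Ω) ε δ) ?_ ?_ ?_ ?_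
  · exact ⟨1, one_pos, fun x hx => hx.1.elim⟩
  · rintro S S' hSS' ⟨δ, hδ, h⟩
    exact ⟨δ, hδ, fun x hx => h x ⟨hSS' hx.1, hx.2⟩⟩
  · rintro S S' ⟨δ, hδ, hS⟩ ⟨δ', hδ', hS'⟩
    exact ⟨min δ δ', lt_min hδ hδ', fun x ⟨hx, hxΩ⟩ r hr hrδ => hx.elim
      (fun hx => hS x ⟨hx, hxΩ⟩ r hr (hrδ.trans (min_le_left _ _)))
      fun hx => hS' x ⟨hx, hxΩ⟩ r hr (hrδ.trans (min_le_right _ _))⟩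
  · intro x₀ hx₀
    obtain ⟨δ, hδ, h⟩ := hloc x₀ hx₀
    exact ⟨ball x₀ δ, mem_nhdsWithin_of_mem_nhds (ball_mem_nhds x₀ hδ), δ, hδ, h⟩

theorem IsCorkscrewOn.exists_isLowerRegularOn {V : Type*} [NormedAddCommGroup V] [NormedSpace ℝ V]
    [FiniteDimensional ℝ V] [MeasurableSpace V] [BorelSpace V] (μ : Measure V)
    [μ.IsAddHaarMeasure] {Ω S : Set V} {δ : ℝ} (h : IsCorkscrewOn Ω S ε δ) (hε : 0 < ε)
    (hδ : 0 < δ) :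
    ∃ c > 0, IsLowerRegularOn (μ.restrict Ω) S (Module.finrank ℝ V) c := by
  set ρ : ℝ := min δ 1
  have hρ : 0 < ρ := lt_min hδ one_pos
  set v : ℝ≥0 := (μ (ball 0 1)).toNNReal
  have hv : (v : ℝ≥0∞) = μ (ball 0 1) := ENNReal.coe_toNNReal measure_ball_lt_top.ne
  have hv0 : 0 < v := ENNReal.coe_pos.1 (hv ▸ measure_ball_pos μ 0 one_pos)
  set k : ℝ≥0 := (ε * ρ).toNNReal
  have hk : (k : ℝ) = ε * ρ := Real.coe_toNNReal _ (by positivity)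
  have hk0 : 0 < k := Real.toNNReal_pos.2 (by positivity)
  refine ⟨v * k ^ Module.finrank ℝ V, by positivity, fun x hx r hr hr1 => ?_⟩
  have hrho : ρ * r ≤ r := mul_le_of_le_one_left r.coe_nonneg (min_le_right _ _)
  have hrδ : ρ * r ≤ δ :=
    (mul_le_of_le_one_right hρ.le (NNReal.coe_le_one.2 hr1)).trans (min_le_left _ _)
  obtain ⟨y, hy⟩ := h x hx (ρ * r) (by positivity) hrδ
  have hball : ball y (k * r : ℝ≥0) ⊆ ball x r ∩ Ω := by
    rw [NNReal.coe_mul, hk, mul_assoc]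
    exact fun z hz => ⟨ball_subset_ball hrho (hy hz).2, (hy hz).1⟩
  calc ((v * k ^ Module.finrank ℝ V * r ^ (Module.finrank ℝ V : ℝ) : ℝ≥0) : ℝ≥0∞)
      = μ (ball y (k * r : ℝ≥0)) := by
        rw [Measure.addHaar_ball_of_pos μ y (NNReal.coe_pos.2 (mul_pos hk0 hr)), ← hv,
          ← NNReal.coe_pow, ENNReal.ofReal_coe_nnreal, ← ENNReal.coe_mul, NNReal.rpow_natCast]
        congr 1
        ring
    _ ≤ μ (ball x r ∩ Ω) := measure_mono hball
    _ = μ.restrict Ω (ball x r) := (Measure.restrict_apply measurableSet_ball).symm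

end Corkscrew

end FractionalSobolev

namespace FracMusielak

open FractionalSobolev Metric

section Primitive

variable {f : ℝ → ℝ}

theorem primitive_nonneg (hm : Monotone f) (h0 : f 0 = 0) {t : ℝ} (ht : 0 ≤ t) :
    0 ≤ ∫ τ in (0 : ℝ)..t, f τ :=
  intervalIntegral.integral_nonneg ht fun _ hx => h0 ▸ hm hx.1

theorem primitive_pos (hm : StrictMono f) (h0 : f 0 = 0) {t : ℝ} (ht : 0 < t) :
    0 < ∫ τ in (0 : ℝ)..t, f τ :=
  intervalIntegral.intervalIntegral_pos_of_pos_on hm.monotone.intervalIntegrable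
    (fun _ hx => h0 ▸ hm hx.1) ht

theorem primitive_le_mul (hm : Monotone f) {t : ℝ} (ht : 0 ≤ t) :
    ∫ τ in (0 : ℝ)..t, f τ ≤ t * f t := by
  calc ∫ τ in (0 : ℝ)..t, f τ ≤ ∫ _ in (0 : ℝ)..t, f t :=
        intervalIntegral.integral_mono_on ht hm.intervalIntegrable intervalIntegrable_const
          fun _ hx => hm hx.2
    _ = t * f t := by rw [intervalIntegral.integral_const, sub_zero, smul_eq_mul]

theorem primitive_div_le (hm : Monotone f) {t k : ℝ} (ht : 0 ≤ t) (hk : 1 ≤ k) :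
    ∫ τ in (0 : ℝ)..(t / k), f τ ≤ (∫ τ in (0 : ℝ)..t, f τ) / k := by
  have hk0 : 0 < k := one_pos.trans_le hk
  have hscale := intervalIntegral.integral_comp_div (a := 0) (b := t) f hk0.ne'
  rw [zero_div, smul_eq_mul] at hscale
  rw [le_div_iff₀ hk0, mul_comm, ← hscale]
  have hmk : Monotone fun x => f (x / k) := hm.comp (monotone_div_right_of_nonneg hk0.le)
  exact intervalIntegral.integral_mono_on ht hmk.intervalIntegrable hm.intervalIntegrable
    fun x hx => hm (div_le_self hx.1 hk)

theorem primitive_one_mul_rpow_le (hf : Continuous f) {p : ℝ}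
    (hgrow : ∀ t : ℝ, 0 < t → p * (∫ τ in (0 : ℝ)..t, f τ) ≤ t * f t) {t : ℝ} (ht : 1 ≤ t) :
    (∫ τ in (0 : ℝ)..1, f τ) * t ^ p ≤ ∫ τ in (0 : ℝ)..t, f τ := by
  set P : ℝ → ℝ := fun t => ∫ τ in (0 : ℝ)..t, f τ
  have hderiv : ∀ r : ℝ, 0 < r →
      HasDerivAt (fun r => P r * r ^ (-p)) ((r * f r - p * P r) * r ^ (-p - 1)) r := fun r hr => by
    refine ((hf.integral_hasStrictDerivAt 0 r).hasDerivAt.mul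
      (Real.hasDerivAt_rpow_const (p := -p) (Or.inl hr.ne'))).congr_deriv ?_
    rw [Real.rpow_sub_one hr.ne']
    field_simp
    ring
  have hmono : MonotoneOn (fun r => P r * r ^ (-p)) (Ici 1) := by
    have hpos : ∀ r ∈ Ici (1 : ℝ), 0 < r := fun r hr => one_pos.trans_le hr
    refine monotoneOn_of_hasDerivWithinAt_nonneg (convex_Ici 1)
      (fun r hr => (hderiv r (hpos r hr)).continuousAt.continuousWithinAt)
      (fun r hr => (hderiv r (hpos r (interior_subset hr))).hasDerivWithinAt) fun r hr => ?_
    have hr0 := hpos r (interior_subset hr)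
    exact mul_nonneg (sub_nonneg.2 (hgrow r hr0)) (Real.rpow_nonneg hr0.le _)
  have hle : P 1 ≤ P t * t ^ (-p) := by simpa using hmono self_mem_Ici ht ht
  have ht0 : 0 < t := one_pos.trans_le ht
  calc P 1 * t ^ p ≤ P t * t ^ (-p) * t ^ p := by gcongr
    _ = P t := by rw [mul_assoc, ← Real.rpow_add ht0, neg_add_cancel, Real.rpow_zero, mul_one]

end Primitive

variable {N : ℕ} {Ω : Set (E N)} {a : E N → E N → ℝ → ℝ} {x y : E N} {s σ : ℝ}

section Growth

theorem phi_zero (a : E N → E N → ℝ → ℝ) (x y : E N) : phi a x y 0 = 0 := if_pos rfl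

namespace IsMusielak

theorem Phi_nonneg (ha : IsMusielak Ω a) (hx : x ∈ closure Ω) (hy : y ∈ closure Ω) {t : ℝ}
    (ht : 0 ≤ t) : 0 ≤ Phi a x y t :=
  primitive_nonneg (ha.strictMono x hx y hy).monotone (phi_zero a x y) ht

theorem Phi_div_le (ha : IsMusielak Ω a) (hx : x ∈ closure Ω) (hy : y ∈ closure Ω) {t k : ℝ}
    (ht : 0 ≤ t) (hk : 1 ≤ k) : Phi a x y (t / k) ≤ Phi a x y t / k :=
  primitive_div_le (ha.strictMono x hx y hy).monotone ht hk

theorem one_le_of_mem_growthSet (ha : IsMusielak Ω a) {r : ℝ} (hr : r ∈ growthSet Ω a) :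
    1 ≤ r := by
  obtain ⟨x, hx, y, hy, t, ht, rfl⟩ := hr
  have hm := ha.strictMono x hx y hy
  exact (one_le_div (primitive_pos hm (phi_zero a x y) ht)).2 (primitive_le_mul hm.monotone ht.le)

theorem one_le_phiMinus (ha : IsMusielak Ω a) (hΩ : Ω.Nonempty) : 1 ≤ phiMinus Ω a := by
  obtain ⟨x, hx⟩ := hΩ.closure
  exact le_csInf ⟨_, x, hx, x, hx, 1, one_pos, rfl⟩ fun r hr => ha.one_le_of_mem_growthSet hr

theorem phiMinus_mul_Phi_le (ha : IsMusielak Ω a) (hx : x ∈ closure Ω) (hy : y ∈ closure Ω) {t : ℝ}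
    (ht : 0 < t) : phiMinus Ω a * Phi a x y t ≤ t * phi a x y t := by
  have hpos : 0 < Phi a x y t := primitive_pos (ha.strictMono x hx y hy) (phi_zero a x y) ht
  exact (le_div_iff₀ hpos).1 (csInf_le ⟨1, fun r hr => ha.one_le_of_mem_growthSet hr⟩
    ⟨x, hx, y, hy, t, ht, rfl⟩)

theorem rpow_phiMinus_le (ha : IsMusielak Ω a) {c : ℝ} (hc : 0 < c) (hx : x ∈ closure Ω)
    (hy : y ∈ closure Ω) (hcx : c ≤ Phi a x y 1) {t : ℝ} (ht : 0 ≤ t) :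
    t ^ phiMinus Ω a ≤ 1 + Phi a x y t / c := by
  have hnonneg : 0 ≤ Phi a x y t := ha.Phi_nonneg hx hy ht
  rcases le_total t 1 with ht1 | ht1
  · have hp : 1 ≤ phiMinus Ω a := ha.one_le_phiMinus (closure_nonempty_iff.1 ⟨x, hx⟩)
    exact (Real.rpow_le_one ht ht1 (zero_le_one.trans hp)).trans
      (le_add_of_nonneg_right (by positivity))
  · have hgrow : Phi a x y 1 * t ^ phiMinus Ω a ≤ Phi a x y t :=
      primitive_one_mul_rpow_le (ha.isHomeomorph x hx y hy).continuous
        (fun t ht => ha.phiMinus_mul_Phi_le hx hy ht) ht1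
    have hle : t ^ phiMinus Ω a ≤ Phi a x y t / c :=
      (le_div_iff₀' hc).2 ((mul_le_mul_of_nonneg_right hcx (by positivity)).trans hgrow)
    exact hle.trans (le_add_of_nonneg_left zero_le_one)

theorem le_one_add_Phi (ha : IsMusielak Ω a) {c : ℝ} (hc : 0 < c) (hx : x ∈ closure Ω)
    (hy : y ∈ closure Ω) (hcx : c ≤ Phi a x y 1) {t : ℝ} (ht : 0 ≤ t) :
    t ≤ 1 + Phi a x y t / c := by
  rcases le_total t 1 with ht1 | ht1
  · exact ht1.trans (le_add_of_nonneg_right (div_nonneg (ha.Phi_nonneg hx hy ht) hc.le))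
  · have hp : 1 ≤ phiMinus Ω a := ha.one_le_phiMinus (closure_nonempty_iff.1 ⟨x, hx⟩)
    exact (Real.self_le_rpow_of_one_le ht1 hp).trans (ha.rpow_phiMinus_le hc hx hy hcx ht)

end IsMusielak

end Growth

section Energy

theorem enorm_holderQuotient_rpow {p : ℝ} (hp : 0 < p) (hxy : x ≠ y) (s σ : ℝ) (u : E N → ℝ) :
    ‖holderQuotient (N / p + σ) u (x, y)‖ₑ ^ p =
      .ofReal ((|u x - u y| / ‖x - y‖ ^ s) ^ p * ‖x - y‖ ^ ((s - σ) * p - N)) := by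
  have hd : 0 < ‖x - y‖ := norm_pos_iff.2 (sub_ne_zero.2 hxy)
  have hnorm : ‖holderQuotient (N / p + σ) u (x, y)‖ =
      |u x - u y| / ‖x - y‖ ^ s * ‖x - y‖ ^ (s - σ - N / p) := by
    rw [holderQuotient, norm_smul, Real.norm_of_nonneg (by positivity), dist_eq_norm,
      Real.norm_eq_abs, div_mul_eq_mul_div, mul_div_assoc, ← Real.rpow_sub hd, mul_comm]
    congr 2
    ring
  rw [← ofReal_norm, ENNReal.ofReal_rpow_of_nonneg (norm_nonneg _) hp.le, hnorm,
    Real.mul_rpow (by positivity) (by positivity), ← Real.rpow_mul hd.le]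
  congr 3
  field_simp

theorem IsMusielak.enorm_holderQuotient_rpow_le (ha : IsMusielak Ω a) {c : ℝ} (hc : 0 < c)
    (hσs : σ < s) (u : E N → ℝ) (hx : x ∈ closure Ω) (hy : y ∈ closure Ω) (hcx : c ≤ Phi a x y 1)
    {D : ℝ} (hD : ‖x - y‖ ≤ D) :
    ‖holderQuotient (N / phiMinus Ω a + σ) u (x, y)‖ₑ ^ phiMinus Ω a ≤
      .ofReal (‖x - y‖ ^ ((s - σ) * phiMinus Ω a - N)) +
      .ofReal (D ^ ((s - σ) * phiMinus Ω a) / c) *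
        .ofReal (Phi a x y (|u x - u y| / ‖x - y‖ ^ s) / ‖x - y‖ ^ N) := by
  have hp : 0 < phiMinus Ω a :=
    one_pos.trans_le (ha.one_le_phiMinus (closure_nonempty_iff.1 ⟨x, hx⟩))
  rcases eq_or_ne x y with rfl | hxy
  · simp [holderQuotient, hp]
  rw [enorm_holderQuotient_rpow hp hxy s]
  set p := phiMinus Ω a
  set d := ‖x - y‖
  set t := |u x - u y| / d ^ s
  have hd : 0 < d := norm_pos_iff.2 (sub_ne_zero.2 hxy)
  have hD0 : 0 < D := hd.trans_le hD
  have ht : 0 ≤ t := by positivity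
  have hPhi : 0 ≤ Phi a x y t := ha.Phi_nonneg hx hy ht
  rw [← ENNReal.ofReal_mul (by positivity), ← ENNReal.ofReal_add (by positivity) (by positivity)]
  refine ENNReal.ofReal_le_ofReal ?_
  calc t ^ p * d ^ ((s - σ) * p - N) ≤ (1 + Phi a x y t / c) * d ^ ((s - σ) * p - N) := by
        gcongr
        exact ha.rpow_phiMinus_le hc hx hy hcx ht
    _ = d ^ ((s - σ) * p - N) + d ^ ((s - σ) * p) / c * (Phi a x y t / d ^ N) := by
        rw [Real.rpow_sub hd, Real.rpow_natCast]
        field_simp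
    _ ≤ _ := by gcongr

theorem exists_setLIntegral_norm_sub_rpow_le (hN : 1 ≤ N) (hΩb : Bornology.IsBounded Ω) {β : ℝ}
    (hβ : 0 < β) :
    ∃ J : ℝ≥0, ∀ x ∈ Ω, ∫⁻ y in Ω, .ofReal (‖x - y‖ ^ (β - N)) ≤ (J : ℝ≥0∞) := by
  obtain ⟨D, hD⟩ := Metric.isBounded_iff.1 hΩb
  have hint : IntegrableOn (fun z : E N => ‖z‖ ^ (β - N)) (ball 0 (D + 1)) volume := by
    refine integrableOn_ball_of_norm_le_rpow (C := 1) (α := N - β) (by simpa using hN)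
      (by simpa using hβ) (.of_forall fun z => ?_)
      (measurable_norm.pow_const _).aestronglyMeasurable
    rw [Real.norm_of_nonneg (by positivity), one_mul, neg_sub]
  have hfin : ∫⁻ z in ball (0 : E N) (D + 1), .ofReal (‖z‖ ^ (β - N)) < ∞ :=
    (hasFiniteIntegral_iff_ofReal (.of_forall fun z => by positivity)).1 hint.2
  refine ⟨(∫⁻ z in ball (0 : E N) (D + 1), .ofReal (‖z‖ ^ (β - N))).toNNReal, fun x hx => ?_⟩
  rw [ENNReal.coe_toNNReal hfin.ne]
  have hΩball : Ω ⊆ (x - ·) ⁻¹' ball (0 : E N) (D + 1) := fun y hy => by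
    rw [mem_preimage, mem_ball_zero_iff, ← dist_eq_norm]
    exact (hD hx hy).trans_lt (lt_add_one D)
  calc ∫⁻ y in Ω, .ofReal (‖x - y‖ ^ (β - N))
      ≤ ∫⁻ y in (x - ·) ⁻¹' ball (0 : E N) (D + 1), .ofReal (‖x - y‖ ^ (β - N)) :=
        lintegral_mono_set hΩball
    _ = ∫⁻ z in ball (0 : E N) (D + 1), .ofReal (‖z‖ ^ (β - N)) :=
        (Measure.measurePreserving_sub_left volume x).setLIntegral_comp_preimage
          measurableSet_ball (measurable_norm.pow_const _).ennreal_ofReal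

variable {c : ℝ}

theorem IsMusielak.exists_eLpNorm_one_le (hΩm : MeasurableSet Ω) (hΩb : Bornology.IsBounded Ω)
    (ha : IsMusielak Ω a) (hc : 0 < c) (hcx : ∀ x ∈ Ω, ∀ y ∈ Ω, c ≤ Phi a x y 1) :
    ∃ K : ℝ≥0, ∀ u : E N → ℝ, modular Ω a u ≤ 1 → eLpNorm u 1 (volume.restrict Ω) ≤ K := by
  have hΩfin : volume Ω ≠ ∞ := hΩb.measure_lt_top.ne
  refine ⟨(volume Ω + .ofReal (1 / c)).toNNReal, fun u hu => ?_⟩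
  rw [ENNReal.coe_toNNReal (by finiteness), eLpNorm_one_eq_lintegral_enorm]
  calc ∫⁻ x in Ω, ‖u x‖ₑ ≤ ∫⁻ x in Ω, 1 + .ofReal (1 / c) * .ofReal (Phi a x x |u x|) := by
        refine setLIntegral_mono' hΩm fun x hx => ?_
        have hPhi := ha.Phi_nonneg (subset_closure hx) (subset_closure hx) (abs_nonneg (u x))
        rw [Real.enorm_eq_ofReal_abs, ← ENNReal.ofReal_mul (by positivity), ← ENNReal.ofReal_one,
          ← ENNReal.ofReal_add zero_le_one (by positivity), one_div_mul_eq_div]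
        exact ENNReal.ofReal_le_ofReal (ha.le_one_add_Phi hc (subset_closure hx)
          (subset_closure hx) (hcx x hx x hx) (abs_nonneg _))
    _ = volume Ω + .ofReal (1 / c) * modular Ω a u := by
        rw [lintegral_add_left measurable_const, lintegral_const_mul' _ _ ENNReal.ofReal_ne_top,
          setLIntegral_one, modular]
    _ ≤ _ := by
        gcongr
        exact mul_le_of_le_one_right' hu

theorem IsMusielak.exists_gagliardoNorm_le (hN : 1 ≤ N) (hΩm : MeasurableSet Ω)
    (hΩb : Bornology.IsBounded Ω) (hΩ : Ω.Nonempty) (ha : IsMusielak Ω a) (hc : 0 < c)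
    (hcx : ∀ x ∈ Ω, ∀ y ∈ Ω, c ≤ Phi a x y 1) (hσs : σ < s) :
    ∃ K : ℝ≥0, ∀ u : E N → ℝ, AEStronglyMeasurable u (volume.restrict Ω) →
      gagliardoModular Ω a s u ≤ 1 →
        gagliardoNorm (volume.restrict Ω) N (phiMinus Ω a) σ u ≤ K := by
  set p := phiMinus Ω a
  have hp : 0 < p := one_pos.trans_le (ha.one_le_phiMinus hΩ)
  obtain ⟨J, hJ⟩ := exists_setLIntegral_norm_sub_rpow_le hN hΩb (mul_pos (sub_pos.2 hσs) hp)
  obtain ⟨D, hD⟩ := Metric.isBounded_iff.1 hΩb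
  have hΩfin : volume Ω ≠ ∞ := hΩb.measure_lt_top.ne
  set B : ℝ≥0∞ := .ofReal (D ^ ((s - σ) * p) / c)
  have hKfin : (J * volume Ω + B) ^ (1 / p) ≠ ∞ := by finiteness
  refine ⟨((J * volume Ω + B) ^ (1 / p)).toNNReal, fun u hu hmod => ?_⟩
  rw [ENNReal.coe_toNNReal hKfin, gagliardoNorm, eLpNorm']
  gcongr
  have hmeas : ∀ x : E N, Measurable fun y : E N =>
      ENNReal.ofReal (‖x - y‖ ^ ((s - σ) * p - N)) := fun x =>
    ((measurable_const.sub measurable_id).norm.pow_const _).ennreal_ofReal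
  rw [lintegral_prod _ ((aestronglyMeasurable_holderQuotient hu _).enorm.pow_const p)]
  calc ∫⁻ x in Ω, ∫⁻ y in Ω, ‖holderQuotient (N / p + σ) u (x, y)‖ₑ ^ p
      ≤ ∫⁻ x in Ω, ∫⁻ y in Ω, (.ofReal (‖x - y‖ ^ ((s - σ) * p - N)) +
          B * .ofReal (Phi a x y (|u x - u y| / ‖x - y‖ ^ s) / ‖x - y‖ ^ N)) :=
        setLIntegral_mono' hΩm fun x hx => setLIntegral_mono' hΩm fun y hy =>
          ha.enorm_holderQuotient_rpow_le hc hσs u (subset_closure hx) (subset_closure hy)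
            (hcx x hx y hy) (dist_eq_norm x y ▸ hD hx hy)
    _ ≤ ∫⁻ x in Ω, (J + B * ∫⁻ y in Ω,
          .ofReal (Phi a x y (|u x - u y| / ‖x - y‖ ^ s) / ‖x - y‖ ^ N)) := by
        refine setLIntegral_mono' hΩm fun x hx => ?_
        rw [lintegral_add_left (hmeas x), lintegral_const_mul' _ _ ENNReal.ofReal_ne_top]
        gcongr
        exact hJ x hx
    _ = J * volume Ω + B * gagliardoModular Ω a s u := by
        rw [lintegral_add_left measurable_const, lintegral_const_mul' _ _ ENNReal.ofReal_ne_top,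
          setLIntegral_const, gagliardoModular]
    _ ≤ J * volume Ω + B := by
        gcongr
        exact mul_le_of_le_one_right' hmod

end Energy

section Luxemburg

theorem sInf_nonneg_of_pos (P : ℝ → Prop) : 0 ≤ sInf {l : ℝ | 0 < l ∧ P l} :=
  Real.sInf_nonneg fun _ hl => hl.1.le

section Scaling

variable {α : Type*} {m : (α → ℝ) → ℝ≥0∞} {u : α → ℝ}

theorem exists_pos_le_one_of_scaling
    (hm : ∀ (u : α → ℝ) (k : ℝ), 1 ≤ k → m (fun x => u x / k) ≤ .ofReal k⁻¹ * m u)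
    (hu : ∃ l : ℝ, 0 < l ∧ m (fun x => l * u x) < ∞) :
    {l : ℝ | 0 < l ∧ m (fun x => u x / l) ≤ 1}.Nonempty := by
  obtain ⟨l, hl, hfin⟩ := hu
  set M : ℝ := (m fun x => l * u x).toReal
  have hM : 0 ≤ M := ENNReal.toReal_nonneg
  have hscale : (fun x => u x / ((M + 1) / l)) = fun x => l * u x / (M + 1) := by
    ext x
    field_simp
  refine ⟨(M + 1) / l, by positivity, ?_⟩
  rw [hscale]
  calc m (fun x => l * u x / (M + 1)) ≤ .ofReal (M + 1)⁻¹ * m (fun x => l * u x) :=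
        hm _ _ (le_add_of_nonneg_left hM)
    _ = .ofReal ((M + 1)⁻¹ * M) := by
        rw [ENNReal.ofReal_mul (by positivity), ENNReal.ofReal_toReal hfin.ne]
    _ ≤ 1 := by
        rw [ENNReal.ofReal_le_one, inv_mul_le_iff₀ (by positivity), mul_one]
        exact (lt_add_one M).le

theorem le_one_of_sInf_lt
    (hm : ∀ (u : α → ℝ) (k : ℝ), 1 ≤ k → m (fun x => u x / k) ≤ .ofReal k⁻¹ * m u)
    (hu : ∃ l : ℝ, 0 < l ∧ m (fun x => l * u x) < ∞) {r : ℝ}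
    (hr : sInf {l : ℝ | 0 < l ∧ m (fun x => u x / l) ≤ 1} < r) : m (fun x => u x / r) ≤ 1 := by
  obtain ⟨l, ⟨hl, hle⟩, hlr⟩ := exists_lt_of_csInf_lt (exists_pos_le_one_of_scaling hm hu) hr
  have hk : 1 ≤ r / l := (one_le_div hl).2 hlr.le
  have hscale : (fun x => u x / r) = fun x => u x / l / (r / l) := by
    ext x
    rw [div_div, mul_div_cancel₀ _ hl.ne']
  rw [hscale]
  exact (hm _ _ hk).trans (mul_le_one' (ENNReal.ofReal_le_one.2 (inv_le_one_of_one_le₀ hk)) hle)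

end Scaling

theorem modular_div_le (hΩm : MeasurableSet Ω) (ha : IsMusielak Ω a) (u : E N → ℝ) {k : ℝ}
    (hk : 1 ≤ k) : modular Ω a (fun x => u x / k) ≤ .ofReal k⁻¹ * modular Ω a u := by
  have hk0 : 0 < k := one_pos.trans_le hk
  rw [modular, modular, ← lintegral_const_mul' _ _ ENNReal.ofReal_ne_top]
  refine setLIntegral_mono' hΩm fun x hx => ?_
  rw [← ENNReal.ofReal_mul (by positivity), abs_div, abs_of_pos hk0, inv_mul_eq_div]
  exact ENNReal.ofReal_le_ofReal
    (ha.Phi_div_le (subset_closure hx) (subset_closure hx) (abs_nonneg _) hk)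

theorem gagliardoModular_div_le (hΩm : MeasurableSet Ω) (ha : IsMusielak Ω a) (s : ℝ)
    (u : E N → ℝ) {k : ℝ} (hk : 1 ≤ k) :
    gagliardoModular Ω a s (fun x => u x / k) ≤ .ofReal k⁻¹ * gagliardoModular Ω a s u := by
  have hk0 : 0 < k := one_pos.trans_le hk
  simp only [gagliardoModular, ← lintegral_const_mul' _ _ ENNReal.ofReal_ne_top]
  refine setLIntegral_mono' hΩm fun x hx => setLIntegral_mono' hΩm fun y hy => ?_
  rw [← ENNReal.ofReal_mul (by positivity), ← sub_div, abs_div, abs_of_pos hk0, div_right_comm,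
    ← mul_div_assoc, inv_mul_eq_div]
  gcongr
  exact ha.Phi_div_le (subset_closure hx) (subset_closure hy) (by positivity) hk

theorem normW_nonneg (Ω : Set (E N)) (a : E N → E N → ℝ → ℝ) (s : ℝ) (u : E N → ℝ) :
    0 ≤ normW Ω a s u :=
  add_nonneg (sInf_nonneg_of_pos _) (sInf_nonneg_of_pos _)

theorem MemW.modulars_le_one (hΩm : MeasurableSet Ω) (ha : IsMusielak Ω a) {u : E N → ℝ}
    (hu : MemW Ω a s u) {r : ℝ} (hr : normW Ω a s u < r) :
    modular Ω a (fun x => u x / r) ≤ 1 ∧ gagliardoModular Ω a s (fun x => u x / r) ≤ 1 :=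
  ⟨le_one_of_sInf_lt (fun v _ hk => modular_div_le hΩm ha v hk) hu.2.1
      ((le_add_of_nonneg_right (sInf_nonneg_of_pos _)).trans_lt hr),
    le_one_of_sInf_lt (fun v _ hk => gagliardoModular_div_le hΩm ha s v hk) hu.2.2
      ((le_add_of_nonneg_left (sInf_nonneg_of_pos _)).trans_lt hr)⟩

theorem MemW.le_mul_normW_of_homogeneous (hΩm : MeasurableSet Ω) (ha : IsMusielak Ω a)
    {n : (E N → ℝ) → ℝ≥0∞} (hn : ∀ (k : ℝ) u, n (k • u) = ‖k‖ₑ * n u) {K : ℝ≥0}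
    (hK : ∀ u, AEStronglyMeasurable u (volume.restrict Ω) → modular Ω a u ≤ 1 →
      gagliardoModular Ω a s u ≤ 1 → n u ≤ K)
    {u : E N → ℝ} (hu : MemW Ω a s u) : n u ≤ .ofReal (K * normW Ω a s u) := by
  have hbound : ∀ r, normW Ω a s u < r → n u ≤ .ofReal (K * r) := by
    intro r hr
    have hr0 : 0 < r := (normW_nonneg Ω a s u).trans_lt hr
    obtain ⟨hmod, hgag⟩ := hu.modulars_le_one hΩm ha hr
    have hscale : u = r • fun x => u x / r := by
      ext x
      exact (mul_div_cancel₀ _ hr0.ne').symm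
    calc n u = ‖r‖ₑ * n fun x => u x / r := by rw [← hn, ← hscale]
      _ ≤ ‖r‖ₑ * K := by
          have hmeas : AEStronglyMeasurable (fun x => u x / r) (volume.restrict Ω) := by
            simpa only [div_eq_mul_inv] using AEStronglyMeasurable.mul_const hu.1 r⁻¹
          gcongr
          exact hK _ hmeas hmod hgag
      _ = .ofReal (K * r) := by
          rw [Real.enorm_of_nonneg hr0.le, mul_comm, ENNReal.ofReal_mul K.coe_nonneg,
            ENNReal.ofReal_coe_nnreal]
  have hlim : Tendsto (fun r : ℝ => ENNReal.ofReal (K * r)) (𝓝[>] normW Ω a s u)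
      (𝓝 (.ofReal (K * normW Ω a s u))) :=
    ((ENNReal.continuous_ofReal.comp (continuous_const.mul continuous_id)).tendsto _).mono_left
      nhdsWithin_le_nhds
  exact ge_of_tendsto hlim (eventually_nhdsWithin_of_forall hbound)

end Luxemburg

section Embedding

theorem IsMusielak.exists_norms_le_mul_normW (hN : 1 ≤ N) (hΩm : MeasurableSet Ω)
    (hΩb : Bornology.IsBounded Ω) (hΩ : Ω.Nonempty) (ha : IsMusielak Ω a)
    (hpos : ∃ c : ℝ, 0 < c ∧ ∀ x ∈ Ω, ∀ y ∈ Ω, c ≤ Phi a x y 1) (hσs : σ < s) :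
    ∃ K : ℝ≥0, ∀ u, MemW Ω a s u →
      eLpNorm u 1 (volume.restrict Ω) ≤ .ofReal (K * normW Ω a s u) ∧
      gagliardoNorm (volume.restrict Ω) N (phiMinus Ω a) σ u ≤ .ofReal (K * normW Ω a s u) := by
  have hp : 0 < phiMinus Ω a := one_pos.trans_le (ha.one_le_phiMinus hΩ)
  obtain ⟨c, hc, hcx⟩ := hpos
  obtain ⟨K₁, hK₁⟩ := ha.exists_eLpNorm_one_le hΩm hΩb hc hcx
  obtain ⟨K₂, hK₂⟩ := ha.exists_gagliardoNorm_le hN hΩm hΩb hΩ hc hcx hσs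
  refine ⟨max K₁ K₂, fun u hu => ⟨?_, ?_⟩⟩
  · exact hu.le_mul_normW_of_homogeneous hΩm ha (fun k u => eLpNorm_const_smul k u 1 _)
      fun v _ hv _ => (hK₁ v hv).trans (ENNReal.coe_le_coe.2 (le_max_left _ _))
  · exact hu.le_mul_normW_of_homogeneous hΩm ha (fun k u => gagliardoNorm_const_smul hp k u)
      fun v hvm _ hv => (hK₂ v hvm hv).trans (ENNReal.coe_le_coe.2 (le_max_right _ _))

variable {c : ℝ≥0} {q : ℝ≥0∞}

theorem IsMusielak.continuouslyEmbedded_of_ehrling (hN : 1 ≤ N) (hΩm : MeasurableSet Ω)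
    (hΩb : Bornology.IsBounded Ω) (hΩ : Ω.Nonempty) (ha : IsMusielak Ω a)
    (hpos : ∃ c : ℝ, 0 < c ∧ ∀ x ∈ Ω, ∀ y ∈ Ω, c ≤ Phi a x y 1) (hσs : σ < s)
    (hE : Ehrling ℝ (volume.restrict Ω) N (phiMinus Ω a) σ 1 q) :
    ContinuouslyEmbedded Ω a s q := by
  obtain ⟨K, hK⟩ := ha.exists_norms_le_mul_normW hN hΩm hΩb hΩ hpos hσs
  obtain ⟨C, hC⟩ := hE 1 one_pos
  refine ⟨(1 + C) * K, by positivity, fun u hu => ?_⟩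
  obtain ⟨hu1, huG⟩ := hK u hu
  have hle : eLpNorm u q (volume.restrict Ω) ≤ .ofReal ((1 + C) * K * normW Ω a s u) :=
    calc eLpNorm u q (volume.restrict Ω)
        ≤ (1 : ℝ≥0) * .ofReal (K * normW Ω a s u) + C * .ofReal (K * normW Ω a s u) :=
          (hC u hu.1).trans (by gcongr)
      _ = .ofReal ((1 + C) * K * normW Ω a s u) := by
          rw [← add_mul, ← ENNReal.coe_add, ← ENNReal.ofReal_coe_nnreal,
            ← ENNReal.ofReal_mul (by positivity), ← mul_assoc, NNReal.coe_add, NNReal.coe_one]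
  exact ⟨⟨hu.1, hle.trans_lt ENNReal.ofReal_lt_top⟩, hle⟩

theorem IsMusielak.compactlyEmbedded_of_ehrling (hN : 1 ≤ N) (hΩm : MeasurableSet Ω)
    (hΩb : Bornology.IsBounded Ω) (hΩ : Ω.Nonempty)
    (hreg : IsLowerRegularOn (volume.restrict Ω) Ω N c) (hc : 0 < c) (ha : IsMusielak Ω a)
    (hpos : ∃ c : ℝ, 0 < c ∧ ∀ x ∈ Ω, ∀ y ∈ Ω, c ≤ Phi a x y 1) (hσ : 0 < σ) (hσs : σ < s)
    (hq : 1 ≤ q) (hE : Ehrling ℝ (volume.restrict Ω) N (phiMinus Ω a) σ 1 q) :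
    CompactlyEmbedded Ω a s q := by
  have hcont := ha.continuouslyEmbedded_of_ehrling hN hΩm hΩb hΩ hpos hσs hE
  refine ⟨hcont, fun u hu ⟨R, hR⟩ => ?_⟩
  obtain ⟨C, -, hC⟩ := hcont
  obtain ⟨K, hK⟩ := ha.exists_norms_le_mul_normW hN hΩm hΩb hΩ hpos hσs
  have : IsFiniteMeasure (volume.restrict Ω) := isFiniteMeasure_restrict.2 hΩb.measure_lt_top.ne
  have hKR : ∀ n, ENNReal.ofReal (K * normW Ω a s (u n)) ≤ ((K * R).toNNReal : ℝ≥0∞) := fun n =>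
    ENNReal.ofReal_le_ofReal (by gcongr; exact hR n)
  have hΩtb : TotallyBounded Ω := hΩb.isCompact_closure.totallyBounded.subset subset_closure
  exact hreg.exists_subseq_tendsto_eLpNorm (ae_restrict_mem hΩm) hΩtb hc N.cast_nonneg
    (ha.one_le_phiMinus hΩ) hσ hq hE (fun n => (hC _ (hu n)).1)
    (fun n => (hK _ (hu n)).1.trans (hKR n)) fun n => (hK _ (hu n)).2.trans (hKR n)

end Embedding

section LipschitzDomain

/-- The inscribed balls come from moving a point of the half cylinder towards the origin and
upwards. -/
theorem exists_ball_subset_cylPos {z : E (N - 1) × ℝ} (hz : z ∈ cylPos N) {t : ℝ} (ht : 0 < t)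
    (ht1 : t ≤ 1) : ∃ w, ball w (t / 2) ⊆ cylPos N ∧ dist w z ≤ t := by
  obtain ⟨⟨hz1, hz2⟩, hz0⟩ := hz
  rw [abs_lt] at hz2
  have hnorm : ‖(1 - t) • z.1‖ ≤ 1 - t := by
    rw [norm_smul, Real.norm_of_nonneg (sub_nonneg.2 ht1)]
    exact mul_le_of_le_one_right (sub_nonneg.2 ht1) hz1.le
  have hshift : (1 - t) • z.1 - z.1 = -(t • z.1) := by
    rw [sub_smul, one_smul]
    abel
  refine ⟨((1 - t) • z.1, (1 - t) * z.2 + t / 2), fun y hy => ?_, ?_⟩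
  · obtain ⟨hy1, hy2⟩ := max_lt_iff.1 (mem_ball.1 hy)
    rw [Real.dist_eq, abs_lt] at hy2
    rw [dist_eq_norm] at hy1
    have hynorm : ‖y.1‖ ≤ ‖y.1 - (1 - t) • z.1‖ + ‖(1 - t) • z.1‖ := norm_le_norm_sub_add _ _
    refine ⟨⟨by linarith, abs_lt.2 ⟨?_, ?_⟩⟩, ?_⟩ <;> nlinarith
  · rw [Prod.dist_eq, dist_eq_norm, hshift, norm_neg, norm_smul, Real.norm_of_nonneg ht.le,
      Real.dist_eq]
    exact max_le (mul_le_of_le_one_right ht.le hz1.le)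
      (abs_le.2 ⟨by nlinarith, by nlinarith⟩)

theorem isCorkscrewOn_cylPos (N : ℕ) : IsCorkscrewOn (cylPos N) (cylPos N) (1 / 4) 1 := by
  intro z hz r hr hr1
  obtain ⟨w, hw, hwz⟩ := exists_ball_subset_cylPos hz (half_pos hr) (by linarith)
  refine ⟨w, subset_inter ((ball_subset_ball (by linarith)).trans hw) (ball_subset_ball' ?_)⟩
  linarith

theorem IsLipschitzDomain.exists_isCorkscrewOn (hΩl : IsLipschitzDomain Ω) (hΩo : IsOpen Ω)
    (hΩb : Bornology.IsBounded Ω) : ∃ ε > 0, ∃ δ > 0, IsCorkscrewOn Ω Ω ε δ := by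
  obtain ⟨M₀, hcharts⟩ := hΩl
  set M := max 1 M₀
  have hM : (1 : ℝ) ≤ M := le_max_left 1 M₀
  refine ⟨1 / 4 / (M : ℝ) ^ 2, by positivity,
    exists_isCorkscrewOn_of_isCompact_closure hΩb.isCompact_closure fun x₀ hx₀ => ?_⟩
  by_cases hx₀Ω : x₀ ∈ Ω
  · have hε1 : 1 / 4 / (M : ℝ) ^ 2 ≤ 1 :=
      div_le_one_of_le₀ (le_trans (by norm_num) (one_le_pow₀ hM)) (by positivity)
    obtain ⟨δ, hδ, h⟩ := exists_isCorkscrewOn_ball hΩo hε1 hx₀Ω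
    exact ⟨δ, hδ, fun x hx => h x hx.1⟩
  · obtain ⟨U, hU, hx₀U, T, T', hinv, hTU, hT, hT', hTpos, -⟩ :=
      hcharts x₀ ⟨hx₀, by rwa [hΩo.interior_eq]⟩
    exact (isCorkscrewOn_cylPos N).exists_of_chart (by norm_num) (by norm_num) (fun z hz => hz.1)
      hU hinv hTU.subset (le_max_left 1 M₀) (hT.weaken (le_max_right 1 M₀))
      (hT'.weaken (le_max_right 1 M₀)) hTpos hx₀U

theorem IsLipschitzDomain.exists_isLowerRegularOn (hΩl : IsLipschitzDomain Ω) (hΩo : IsOpen Ω)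
    (hΩb : Bornology.IsBounded Ω) : ∃ c > 0, IsLowerRegularOn (volume.restrict Ω) Ω N c := by
  obtain ⟨ε, hε, δ, hδ, h⟩ := hΩl.exists_isCorkscrewOn hΩo hΩb
  simpa only [finrank_euclideanSpace, Fintype.card_fin] using
    h.exists_isLowerRegularOn volume hε hδ

end LipschitzDomain

section CriticalExponent

theorem le_ofReal_of_le_critExp {s' : ℝ} {q : ℝ≥0∞} (hq : q ≤ critExp Ω a s')
    (hs' : s' * phiMinus Ω a < N) :
    q ≤ .ofReal (N * phiMinus Ω a / (N - s' * phiMinus Ω a)) := by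
  rwa [critExp, if_pos hs'] at hq

theorem le_critExp_of_le {s' : ℝ} (hs' : N ≤ s' * phiMinus Ω a) (q : ℝ≥0∞) :
    q ≤ critExp Ω a s' := by
  rw [critExp, if_neg hs'.not_gt]
  exact le_top

theorem nonempty_of_one_le_critExp {s' : ℝ} (hN : 1 ≤ N) (h : 1 ≤ critExp Ω a s') :
    Ω.Nonempty := by
  by_contra hΩ
  obtain rfl := not_nonempty_iff_eq_empty.1 hΩ
  have hphi : phiMinus (∅ : Set (E N)) a = 0 := by simp [phiMinus, growthSet]
  have hN0 : (0 : ℝ) < N := Nat.cast_pos.2 hN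
  simp [critExp, hphi, hN0] at h

end CriticalExponent

end FracMusielak

end

theorem corollary3p1_general {N : ℕ} (hN : 1 ≤ N) {Ω : Set (FracMusielak.E N)}
    (hΩm : MeasurableSet Ω) (hΩb : Bornology.IsBounded Ω) {c : ℝ≥0} (hc : 0 < c)
    (hΩreg : FractionalSobolev.IsLowerRegularOn (volume.restrict Ω) Ω N c)
    {s s' : ℝ} (hs' : 0 < s') (hs's : s' < s)
    {a : FracMusielak.E N → FracMusielak.E N → ℝ → ℝ} (ha : FracMusielak.IsMusielak Ω a)
    (hpos : ∃ c : ℝ, 0 < c ∧ ∀ x ∈ Ω, ∀ y ∈ Ω, c ≤ FracMusielak.Phi a x y 1) {q : ℝ≥0∞}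
    (hq : 1 ≤ q) (hq' : q ≤ FracMusielak.critExp Ω a s') :
    FracMusielak.CompactlyEmbedded Ω a s q := by
  have hΩ := FracMusielak.nonempty_of_one_le_critExp hN (hq.trans hq')
  have : IsFiniteMeasure (volume.restrict Ω) := isFiniteMeasure_restrict.2 hΩb.measure_lt_top.ne
  obtain ⟨σ, hσ, hσs, hE⟩ := hΩreg.exists_ehrling_of_le_critical (F := ℝ) (ae_restrict_mem hΩm) hc
    (Nat.cast_pos.2 hN) (ha.one_le_phiMinus hΩ) hs' hs's (one_pos.trans_le hq).ne'
    (FracMusielak.le_ofReal_of_le_critExp hq')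
  exact ha.compactlyEmbedded_of_ehrling hN hΩm hΩb hΩ hΩreg hc hpos hσ hσs hq hE

theorem corollary3p1 (N : ℕ) (hN : 1 ≤ N) (Ω : Set (FracMusielak.E N))
    (hΩ_open : IsOpen Ω) (hΩ_bdd : Bornology.IsBounded Ω)
    (hΩ_lip : FracMusielak.IsLipschitzDomain Ω)
    (s s' : ℝ) (hs' : 0 < s') (hs's : s' < s) (hs : s < 1)
    (a : FracMusielak.E N → FracMusielak.E N → ℝ → ℝ)
    (ha : FracMusielak.IsMusielak Ω a)
    (hPhi1 : FracMusielak.GrowthCondition Ω a)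
    (hpos : ∃ c : ℝ, 0 < c ∧ ∀ x ∈ Ω, ∀ y ∈ Ω, c ≤ FracMusielak.Phi a x y 1) :
    (s' * FracMusielak.phiMinus Ω a < N →
      (∀ q : ℝ≥0∞, 1 ≤ q → q ≤ FracMusielak.critExp Ω a s' →
        FracMusielak.ContinuouslyEmbedded Ω a s q) ∧
      (∀ q : ℝ≥0∞, 1 ≤ q → q < FracMusielak.critExp Ω a s' →
        FracMusielak.CompactlyEmbedded Ω a s q)) ∧
    (s' * FracMusielak.phiMinus Ω a = N →
      (∀ q : ℝ≥0∞, 1 ≤ q → FracMusielak.ContinuouslyEmbedded Ω a s q) ∧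
      (∀ q : ℝ≥0∞, 1 ≤ q → q < ∞ → FracMusielak.CompactlyEmbedded Ω a s q)) ∧
    ((N : ℝ) < s' * FracMusielak.phiMinus Ω a →
      FracMusielak.CompactlyEmbedded Ω a s ∞) := by
  obtain ⟨c, hc, hreg⟩ := hΩ_lip.exists_isLowerRegularOn hΩ_open hΩ_bdd
  have hcompact {q : ℝ≥0∞} := corollary3p1_general (q := q) hN hΩ_open.measurableSet hΩ_bdd hc hreg
    hs' hs's ha hpos
  refine ⟨fun _ => ⟨fun q hq hq' => (hcompact hq hq').1, fun q hq hq' => hcompact hq hq'.le⟩,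
    fun heq => ⟨fun q hq => (hcompact hq ?_).1, fun q hq _ => hcompact hq ?_⟩,
    fun hgt => hcompact le_top ?_⟩
  exacts [FracMusielak.le_critExp_of_le heq.ge q, FracMusielak.le_critExp_of_le heq.ge q,
    FracMusielak.le_critExp_of_le hgt.le ∞]
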